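/- Let $n\ge 2$ and let $\Omega\subset\mathbb R^n$ be a bounded domain (nonempty, open, connected) with boundary $\partial\Omega$ of class $C^2$. Let $\mathcal H_{\partial\Omega}$ denote the mean curvature of $\partial\Omega$ with respect to the inner unit normal, i.e. the average of the $n-1$ principal curvatures (so that it equals $1$ for the unit ball). For $f\in C^k(\overline\Omega)$ put $\|f\|_k=\sum_{j=0}^k\sup_{\Omega}\|D^jf\|$, where $\|D^jf\|$ is the operator norm of the $j$-th derivative. There is a constant $C=C(n,\Omega)>0$ such that the following holds. Let $\varphi\in C^2(\overline\Omega)$ and let $H\in C^1(\overline\Omega)$ satisfy the Serrin condition $$(n-1)\,\mathcal H_{\partial\Omega}(y)\ \ge\ n\,|H(y)|\qquad\text{for all } y\in\partial\Omega .$$ If $u\in C^2(\Omega)\cap C^1(\overline\Omega)$ is a solution of the Dirichlet problem $$\operatorname{div}\!\left(\frac{\nabla u}{\sqrt{1+\|\nabla u\|^2}}\right)=n\,H(x)\ \text{ in }\Omega,\qquad u=\varphi\ \text{ on }\partial\Omega,$$ then $$\sup_{\partial\Omega}\|\nabla u\|\ \le\ \|\varphi\|_1+\exp\!\Big(C\,\big(1+\|H\|_1+\|\varphi\|_2\big)\big(1+\|\varphi\|_1\big)^3\big(\|u\|_0+\|\varphi\|_0\big)\Big).$$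 -/

import Mathlib

noncomputable section

namespace PrescribedMC

/-- The `C^k` norm on a domain `Ω`: the sum over `0 ≤ j ≤ k` of `sup_Ω ‖D^j f‖`, where `‖D^j f‖` is
the Euclidean operator norm (`|f|`, `‖∇f‖` and the spectral norm of the Hessian for `j = 0, 1, 2`).
The suprema are finite for functions of class `C^k` on the closure of a bounded domain with
`C²` boundary. -/
def ckNorm {n : ℕ} (Ω : Set (EuclideanSpace ℝ (Fin n))) (k : ℕ)
    (f : EuclideanSpace ℝ (Fin n) → ℝ) : ℝ :=
  ∑ j ∈ Finset.range (k + 1), ⨆ x : Ω, ‖iteratedFDeriv ℝ j f x‖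

/-- The divergence `∑ i, ∂ᵢ Fᵢ` of a vector field. -/
def divergence {n : ℕ} (F : EuclideanSpace ℝ (Fin n) → EuclideanSpace ℝ (Fin n))
    (x : EuclideanSpace ℝ (Fin n)) : ℝ :=
  ∑ i : Fin n, (fderiv ℝ F x (EuclideanSpace.single i 1)) i

/-- The Dirichlet problem for the prescribed mean curvature equation:
`div (∇u / √(1 + ‖∇u‖²)) = n H` in `Ω` and `u = φ` on `∂Ω`. -/
structure IsSolution {n : ℕ} (Ω : Set (EuclideanSpace ℝ (Fin n)))
    (H φ u : EuclideanSpace ℝ (Fin n) → ℝ) : Prop where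
  equation : ∀ x ∈ Ω,
    divergence (fun z => (Real.sqrt (1 + ‖gradient u z‖ ^ 2))⁻¹ • gradient u z) x = n * H x
  boundary : ∀ y ∈ frontier Ω, u y = φ y

/-- `ρ` is a `C²` local defining function of `Ω` at the boundary point `y`: near `y`, `ρ` is `C²`
with nonvanishing gradient and `Ω` is the set `{ρ < 0}` (so that `∂Ω` is the set `{ρ = 0}`). -/
structure IsC2DefiningAt {n : ℕ} (Ω : Set (EuclideanSpace ℝ (Fin n)))
    (ρ : EuclideanSpace ℝ (Fin n) → ℝ) (y : EuclideanSpace ℝ (Fin n)) : Prop where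
  contDiffAt : ContDiffAt ℝ 2 ρ y
  gradient_ne_zero : gradient ρ y ≠ 0
  eq_zero : ρ y = 0
  eventually_mem_iff : ∀ᶠ x in nhds y, (x ∈ Ω ↔ ρ x < 0)

/-- The boundary of `Ω` is of class `C²`. -/
def HasC2Boundary {n : ℕ} (Ω : Set (EuclideanSpace ℝ (Fin n))) : Prop :=
  ∀ y ∈ frontier Ω, ∃ ρ : EuclideanSpace ℝ (Fin n) → ℝ, IsC2DefiningAt Ω ρ y

/-- The unit normal field `N = -∇ρ / ‖∇ρ‖` along the level sets of `ρ`, pointing towards smaller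
values of `ρ`, that is, into `Ω` along `∂Ω` if `ρ` is a local defining function of `Ω`. -/
def unitNormal {n : ℕ} (ρ : EuclideanSpace ℝ (Fin n) → ℝ) (x : EuclideanSpace ℝ (Fin n)) :
    EuclideanSpace ℝ (Fin n) :=
  -(‖gradient ρ x‖⁻¹ • gradient ρ x)

/-- The tangent space at `y` of the level set of `ρ` through `y`: the orthogonal complement
of the normal. -/
def tangentHyperplane {n : ℕ} (ρ : EuclideanSpace ℝ (Fin n) → ℝ)
    (y : EuclideanSpace ℝ (Fin n)) : Submodule ℝ (EuclideanSpace ℝ (Fin n)) :=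
  (Submodule.span ℝ {unitNormal ρ y})ᗮ

/-- The Weingarten map (shape operator) `v ↦ -D_v N` on the tangent space of the level set of `ρ`
through `y`. (As `‖N‖ = 1`, the vector `D_v N` is tangent; the projection only records this.) -/
def weingarten {n : ℕ} (ρ : EuclideanSpace ℝ (Fin n) → ℝ) (y : EuclideanSpace ℝ (Fin n)) :
    tangentHyperplane ρ y →ₗ[ℝ] tangentHyperplane ρ y :=
  -(((tangentHyperplane ρ y).orthogonalProjectionOnto : _ →L[ℝ] tangentHyperplane ρ y).toLinearMap ∘ₗ
    (fderiv ℝ (unitNormal ρ) y).toLinearMap ∘ₗ (tangentHyperplane ρ y).subtype)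

open Classical in
/-- The mean curvature of `∂Ω` at `y` with respect to the inner unit normal: the average of the
`n - 1` principal curvatures, that is, the trace of the Weingarten map divided by `n - 1`
(it equals `1` for the unit ball). The value does not depend on the local defining function `ρ`,
since the normal field along `∂Ω` does not. -/
def boundaryMeanCurvature {n : ℕ} (Ω : Set (EuclideanSpace ℝ (Fin n)))
    (y : EuclideanSpace ℝ (Fin n)) : ℝ :=
  if h : ∃ ρ : EuclideanSpace ℝ (Fin n) → ℝ, IsC2DefiningAt Ω ρ y then
    LinearMap.trace ℝ _ (weingarten (Classical.choose h) y) / ((n : ℝ) - 1)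
  else 0

end PrescribedMC

end

noncomputable section

namespace PrescribedMC

open Filter Topology Set
open scoped RealInnerProductSpace

/-! ### Second-order tests along curves -/

/-! The proof is Serrin's boundary barrier, run by touching so that the distance `d` to the
complement need not be differentiable. With `ψ(s) = log(1 + k s)/ν` and `k = ν exp(ν M)`, the claim
is `u - φ ≤ ψ(d)` on the whole closure (`sub_le_barrier`). Since `ψ(s) ≤ exp(ν M) s` and `u = φ` on
the boundary, this claim and its counterpart for `-u` bound the derivative of `u - φ` at boundary
points by `exp(ν M)`; the derivative of `φ` adds the other term.

If the claim fails, `u - φ - ψ(d)` has a positive maximum at an interior `x`. Let `y` be a nearest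
boundary point and `N` the inner normal there. Sliding the boundary at `y` along `N` shows that `d`
is touched from above along each line through `x` by parabolas whose second derivative is
arbitrarily close to minus the normal curvature at `y` (`IsC2DefiningAt.infDist_le_parabola`). The
maximum conditions then give `∇u = ∇φ + t N` and `D²u ≤ D²φ - ν t² N⊗N - t II`, where `t = ψ'(d)`
and `II` is the second fundamental form at `y`. No collar is needed: positivity of the maximum
forces `t ≥ 1`.

Put into the elliptic operator with `W = √(1 + |∇u|²)`, the trace of `II` yields `-t W² (n-1)ℋ(y)`.
By the Serrin condition this absorbs the cubic part `n |H(y)| W³` of the right-hand side up to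
`O(t²)`. The change of `H` from `y` to `x` costs `O(d W³)`, again `O(t²)` because `t d ≤ 1`. A large
`ν` beats every quadratic error (`barrier_arithmetic`, `mcForm_barrier_lt`), contradicting the
equation. -/

theorem eventually_ge_of_second_deriv_pos {g g' : ℝ → ℝ} {c : ℝ}
    (hg : ∀ᶠ s in 𝓝 (0 : ℝ), HasDerivAt g (g' s) s) (hg' : HasDerivAt g' c 0)
    (h0 : g' 0 = 0) (hc : 0 < c) : ∀ᶠ s in 𝓝 (0 : ℝ), g 0 ≤ g s := by
  have hd : deriv g =ᶠ[𝓝 0] g' := hg.mono fun s hs => hs.deriv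
  have hdd : deriv (deriv g) 0 = c := by rw [hd.deriv_eq, hg'.deriv]
  exact isLocalMin_of_deriv_deriv_pos (by rw [hdd]; exact hc) (by rw [hd.self_of_nhds, h0])
    hg.self_of_nhds.continuousAt

theorem second_deriv_eq_zero_of_eventually_eq {g g' : ℝ → ℝ} {c : ℝ}
    (hg : ∀ᶠ s in 𝓝 (0 : ℝ), HasDerivAt g (g' s) s) (hg' : HasDerivAt g' c 0)
    (h : ∀ᶠ s in 𝓝 (0 : ℝ), g s = g 0) : c = 0 := by
  have h1 : ∀ᶠ s in 𝓝 (0 : ℝ), g' s = 0 := by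
    filter_upwards [hg, h.eventually_nhds] with s hs hs'
    have : HasDerivAt g 0 s := (hasDerivAt_const s (g 0)).congr_of_eventuallyEq hs'
    exact hs.unique this
  exact hg'.unique ((hasDerivAt_const (0 : ℝ) (0 : ℝ)).congr_of_eventuallyEq h1)

/-- If `c` were positive, `0` would be a local minimum as well as a local maximum, so `g` would be
locally constant and `c` would vanish. -/
theorem deriv_eq_zero_and_second_deriv_nonpos {g g' : ℝ → ℝ} {c : ℝ}
    (hg : ∀ᶠ s in 𝓝 (0 : ℝ), HasDerivAt g (g' s) s) (hg' : HasDerivAt g' c 0)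
    (hmax : IsLocalMax g 0) : g' 0 = 0 ∧ c ≤ 0 := by
  have h0 : g' 0 = 0 := hmax.hasDerivAt_eq_zero hg.self_of_nhds
  refine ⟨h0, ?_⟩
  by_contra! hc
  refine hc.ne' (second_deriv_eq_zero_of_eventually_eq hg hg' ?_)
  filter_upwards [hmax, eventually_ge_of_second_deriv_pos hg hg' h0 hc] with s h1 h2
  exact le_antisymm h1 h2

section Curve

variable {E : Type*} [NormedAddCommGroup E] [NormedSpace ℝ E]

theorem hasDerivAt_quadratic_curve (x v w : E) (s : ℝ) :
    HasDerivAt (fun s : ℝ => x + s • v + (s ^ 2) • w) (v + (2 * s) • w) s := by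
  have h1 : HasDerivAt (fun s : ℝ => s • v) v s := by
    simpa using (hasDerivAt_id s).smul_const v
  have h2 : HasDerivAt (fun s : ℝ => (s ^ 2) • w) ((2 * s) • w) s := by
    simpa using (hasDerivAt_pow 2 s).smul_const w
  exact (h1.const_add x).add h2

/-- One chain rule serves both uses: lines (`w = 0`) in the touching argument, and parabolas bending
along the normal in the comparison with the boundary. -/
theorem hasDerivAt_comp_quadratic_curve {f : E → ℝ} {x : E} (hf : ContDiffAt ℝ 2 f x) (v w : E) :
    (∀ᶠ s in 𝓝 (0 : ℝ), HasDerivAt (fun s : ℝ => f (x + s • v + (s ^ 2) • w))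
      (fderiv ℝ f (x + s • v + (s ^ 2) • w) (v + (2 * s) • w)) s) ∧
    HasDerivAt (fun s : ℝ => fderiv ℝ f (x + s • v + (s ^ 2) • w) (v + (2 * s) • w))
      (fderiv ℝ (fderiv ℝ f) x v v + 2 * fderiv ℝ f x w) 0 := by
  have hγ := hasDerivAt_quadratic_curve x v w
  have hγ0 : x + (0 : ℝ) • v + ((0 : ℝ) ^ 2) • w = x := by simp
  constructor
  · have h1 : ∀ᶠ z in 𝓝 x, DifferentiableAt ℝ f z :=
      (hf.eventually (by simp)).mono fun z hz => hz.differentiableAt (by simp)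
    have h2 : Tendsto (fun s : ℝ => x + s • v + (s ^ 2) • w) (𝓝 0) (𝓝 x) := by
      simpa [hγ0] using (hγ 0).continuousAt.tendsto
    filter_upwards [h2.eventually h1] with s hs
    exact hs.hasFDerivAt.comp_hasDerivAt s (hγ s)
  · have hd : DifferentiableAt ℝ (fderiv ℝ f) x :=
      (hf.fderiv_right (m := 1) (by norm_num)).differentiableAt (by simp)
    have h1 : HasDerivAt (fun s : ℝ => fderiv ℝ f (x + s • v + (s ^ 2) • w))
        (fderiv ℝ (fderiv ℝ f) x v) 0 := by
      have h := hγ 0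
      simp only [mul_zero, zero_smul, add_zero] at h
      refine HasFDerivAt.comp_hasDerivAt (0 : ℝ) ?_ h
      rw [hγ0]; exact hd.hasFDerivAt
    have h2 : HasDerivAt (fun s : ℝ => v + (2 * s) • w) ((2 : ℝ) • w) 0 := by
      have := (((hasDerivAt_id (0 : ℝ)).const_mul 2).smul_const w).const_add v
      simpa using this
    have h3 := h1.clm_apply h2
    simpa using h3

/-- Second-order necessary conditions at a maximum of `f - ψ(q)` along a line, where `q` is a
quadratic polynomial of the parameter. -/
theorem second_order_of_isLocalMax_line {f : E → ℝ} {x : E}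
    (hf : ContDiffAt ℝ 2 f x) (v : E) {ψ ψ' : ℝ → ℝ} {a b c m : ℝ}
    (hψ : ∀ᶠ s in 𝓝 a, HasDerivAt ψ (ψ' s) s) (hψ' : HasDerivAt ψ' m a)
    (hmax : IsLocalMax (fun s : ℝ => f (x + s • v) - ψ (a + s * b + s ^ 2 * c)) 0) :
    fderiv ℝ f x v = ψ' a * b ∧
      fderiv ℝ (fderiv ℝ f) x v v ≤ m * b ^ 2 + 2 * c * ψ' a := by
  obtain ⟨h1, h2⟩ := hasDerivAt_comp_quadratic_curve hf v 0
  simp only [smul_zero, add_zero, map_zero, mul_zero] at h1 h2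
  have hq : ∀ s : ℝ, HasDerivAt (fun s : ℝ => a + s * b + s ^ 2 * c) (b + 2 * s * c) s := by
    intro s
    simpa [smul_eq_mul] using hasDerivAt_quadratic_curve a b c s
  have hq0 : a + (0 : ℝ) * b + (0 : ℝ) ^ 2 * c = a := by simp
  have hqt : Tendsto (fun s : ℝ => a + s * b + s ^ 2 * c) (𝓝 0) (𝓝 a) := by
    simpa only [hq0] using (hq 0).continuousAt.tendsto
  have hg : ∀ᶠ s in 𝓝 (0 : ℝ),
      HasDerivAt (fun s : ℝ => f (x + s • v) - ψ (a + s * b + s ^ 2 * c))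
        (fderiv ℝ f (x + s • v) v - ψ' (a + s * b + s ^ 2 * c) * (b + 2 * s * c)) s := by
    filter_upwards [h1, hqt.eventually hψ] with s hs hs'
    exact hs.sub (hs'.comp s (hq s))
  have hg' : HasDerivAt (fun s : ℝ => fderiv ℝ f (x + s • v) v
      - ψ' (a + s * b + s ^ 2 * c) * (b + 2 * s * c))
      (fderiv ℝ (fderiv ℝ f) x v v - (m * b * b + ψ' a * (2 * c))) 0 := by
    refine h2.sub ?_
    have h3 : HasDerivAt (fun s : ℝ => ψ' (a + s * b + s ^ 2 * c)) (m * b) 0 := by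
      have := HasDerivAt.comp (0 : ℝ) (h₂ := ψ') (h₂' := m) (by simpa only [hq0] using hψ') (hq 0)
      simpa [Function.comp_def] using this
    have h4 : HasDerivAt (fun s : ℝ => b + 2 * s * c) (2 * c) 0 := by
      simpa using (((hasDerivAt_id (0 : ℝ)).const_mul 2).mul_const c).const_add b
    have h5 := h3.fun_mul h4
    simpa using h5
  obtain ⟨h5, h6⟩ := deriv_eq_zero_and_second_deriv_nonpos hg hg' hmax
  simp at h5
  constructor <;> nlinarith

end Curve

/-! ### Geometry of a local defining function -/

section Geometry

variable {n : ℕ} {Ω : Set (EuclideanSpace ℝ (Fin n))} {ρ σ : EuclideanSpace ℝ (Fin n) → ℝ}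
  {y : EuclideanSpace ℝ (Fin n)}

/-- The second fundamental form of the level set of `ρ` through `y`, extended by zero in the normal
direction. -/
def secondForm (ρ : EuclideanSpace ℝ (Fin n) → ℝ) (y : EuclideanSpace ℝ (Fin n)) :
    EuclideanSpace ℝ (Fin n) →L[ℝ] EuclideanSpace ℝ (Fin n) →L[ℝ] ℝ :=
  ‖gradient ρ y‖⁻¹ • (fderiv ℝ (fderiv ℝ ρ) y).bilinearComp
    (tangentHyperplane ρ y).starProjection (tangentHyperplane ρ y).starProjection

theorem IsC2DefiningAt.norm_unitNormal (h : IsC2DefiningAt Ω ρ y) : ‖unitNormal ρ y‖ = 1 := by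
  have := h.gradient_ne_zero
  simp [unitNormal, norm_smul, this]

theorem IsC2DefiningAt.norm_gradient_pos (h : IsC2DefiningAt Ω ρ y) : 0 < ‖gradient ρ y‖ :=
  norm_pos_iff.2 h.gradient_ne_zero

theorem IsC2DefiningAt.fderiv_apply (h : IsC2DefiningAt Ω ρ y) (w : EuclideanSpace ℝ (Fin n)) :
    fderiv ℝ ρ y w = -(‖gradient ρ y‖ * ⟪unitNormal ρ y, w⟫) := by
  rw [← inner_gradient_left, unitNormal, inner_neg_left, real_inner_smul_left]
  have := h.norm_gradient_pos.ne'
  field_simp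

theorem IsC2DefiningAt.starProjection_apply (h : IsC2DefiningAt Ω ρ y)
    (v : EuclideanSpace ℝ (Fin n)) :
    (tangentHyperplane ρ y).starProjection v = v - ⟪unitNormal ρ y, v⟫ • unitNormal ρ y := by
  rw [tangentHyperplane, Submodule.starProjection_orthogonal']
  simp [Submodule.starProjection_unit_singleton ℝ h.norm_unitNormal]

theorem IsC2DefiningAt.inner_starProjection (h : IsC2DefiningAt Ω ρ y)
    (v : EuclideanSpace ℝ (Fin n)) :
    ⟪unitNormal ρ y, (tangentHyperplane ρ y).starProjection v⟫ = 0 := by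
  rw [h.starProjection_apply, inner_sub_right, real_inner_smul_right,
    real_inner_self_eq_norm_sq, h.norm_unitNormal]
  ring

theorem IsC2DefiningAt.secondForm_apply_normal (h : IsC2DefiningAt Ω ρ y)
    (v : EuclideanSpace ℝ (Fin n)) :
    secondForm ρ y (unitNormal ρ y) v = 0 ∧ secondForm ρ y v (unitNormal ρ y) = 0 := by
  have : (tangentHyperplane ρ y).starProjection (unitNormal ρ y) = 0 := by
    rw [h.starProjection_apply, real_inner_self_eq_norm_sq, h.norm_unitNormal]
    simp
  simp [secondForm, this]

/-- Points `y + s v` with `v` pointing inside lie in `Ω` for small `s > 0`. -/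
theorem IsC2DefiningAt.eventually_mem (h : IsC2DefiningAt Ω ρ y) {v : EuclideanSpace ℝ (Fin n)}
    (hv : 0 < ⟪unitNormal ρ y, v⟫) : ∀ᶠ s in 𝓝[>] (0 : ℝ), y + s • v ∈ Ω := by
  have hd : HasDerivAt (fun s : ℝ => ρ (y + s • v)) (fderiv ℝ ρ y v) 0 := by
    have h1 := (hasDerivAt_comp_quadratic_curve h.contDiffAt v 0).1.self_of_nhds
    simpa using h1
  have hneg : fderiv ℝ ρ y v < 0 := by
    rw [h.fderiv_apply]; have := h.norm_gradient_pos; nlinarith [mul_pos this hv]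
  have ht : Tendsto (fun s : ℝ => y + s • v) (𝓝[>] 0) (𝓝 y) := by
    have : Continuous (fun s : ℝ => y + s • v) := by fun_prop
    simpa using (this.tendsto 0).mono_left nhdsWithin_le_nhds
  have hs := (hasDerivAt_iff_tendsto_slope_zero.1 hd).mono_left
    (nhdsWithin_mono 0 (fun s (hs : 0 < s) => hs.ne'))
  filter_upwards [ht.eventually h.eventually_mem_iff, hs.eventually (gt_mem_nhds hneg),
    self_mem_nhdsWithin] with s h1 h2 h3
  rw [h1]
  simp only [zero_add, zero_smul, add_zero, h.eq_zero, sub_zero, smul_eq_mul] at h2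
  have h3' : (0 : ℝ) < s := h3
  have := inv_pos.2 h3'
  by_contra! h4
  nlinarith [mul_nonneg this.le h4]

/-- Points `y + s v` with `v` pointing outside avoid `Ω` for small `s > 0`. -/
theorem IsC2DefiningAt.eventually_notMem (h : IsC2DefiningAt Ω ρ y)
    {v : EuclideanSpace ℝ (Fin n)}
    (hv : ⟪unitNormal ρ y, v⟫ < 0) : ∀ᶠ s in 𝓝[>] (0 : ℝ), y + s • v ∉ Ω := by
  have hd : HasDerivAt (fun s : ℝ => ρ (y + s • v)) (fderiv ℝ ρ y v) 0 := by
    have h1 := (hasDerivAt_comp_quadratic_curve h.contDiffAt v 0).1.self_of_nhds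
    simpa using h1
  have hpos : 0 < fderiv ℝ ρ y v := by
    rw [h.fderiv_apply]; 
    nlinarith [mul_pos_of_neg_of_neg (neg_lt_zero.2 h.norm_gradient_pos) hv]
  have ht : Tendsto (fun s : ℝ => y + s • v) (𝓝[>] 0) (𝓝 y) := by
    have : Continuous (fun s : ℝ => y + s • v) := by fun_prop
    simpa using (this.tendsto 0).mono_left nhdsWithin_le_nhds
  have hs := (hasDerivAt_iff_tendsto_slope_zero.1 hd).mono_left
    (nhdsWithin_mono 0 (fun s (hs : 0 < s) => hs.ne'))
  filter_upwards [ht.eventually h.eventually_mem_iff, hs.eventually (lt_mem_nhds hpos),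
    self_mem_nhdsWithin] with s h1 h2 h3
  rw [h1]
  simp only [zero_add, zero_smul, add_zero, h.eq_zero, sub_zero, smul_eq_mul] at h2
  have h3' : (0 : ℝ) < s := h3
  have := inv_pos.2 h3'
  intro h4
  nlinarith [mul_neg_of_pos_of_neg this h4]

/-- A vector whose closed negative half space contains the open one of a unit vector `N` is a
nonnegative multiple of `N`. -/
theorem eq_norm_smul_of_inner_neg_imp_nonpos {N w : EuclideanSpace ℝ (Fin n)} (hN : ‖N‖ = 1)
    (h : ∀ v : EuclideanSpace ℝ (Fin n), ⟪N, v⟫ < 0 → ⟪w, v⟫ ≤ 0) : w = ‖w‖ • N := by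
  have key : ∀ v : EuclideanSpace ℝ (Fin n), ⟪N, v⟫ = 0 → ⟪w, v⟫ ≤ 0 := by
    intro v hv
    have ht : Tendsto (fun ε : ℝ => ⟪w, v - ε • N⟫) (𝓝[>] 0) (𝓝 ⟪w, v⟫) := by
      have : Continuous (fun ε : ℝ => ⟪w, v - ε • N⟫) := by fun_prop
      simpa using (this.tendsto 0).mono_left (nhdsWithin_le_nhds (s := Ioi 0))
    refine le_of_tendsto ht ?_
    filter_upwards [self_mem_nhdsWithin] with ε hε
    have hε' : (0 : ℝ) < ε := hε
    apply h
    rw [inner_sub_right, hv, real_inner_smul_right, real_inner_self_eq_norm_sq, hN]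
    linarith
  -- The part of `w` orthogonal to `N` is itself an admissible test vector, and testing against it
  -- gives `‖z‖² ≤ 0`.
  set z := w - ⟪N, w⟫ • N with hz
  have hNN : ⟪N, N⟫ = 1 := by rw [real_inner_self_eq_norm_sq, hN]; norm_num
  have hNz : ⟪N, z⟫ = 0 := by
    rw [hz, inner_sub_right, real_inner_smul_right, hNN]; ring
  have h1 := key z hNz
  have h2 : ⟪w, z⟫ = ⟪z, z⟫ := by
    have : w = z + ⟪N, w⟫ • N := by rw [hz]; simp
    conv_lhs => rw [this]
    rw [inner_add_left, real_inner_smul_left, hNz]; ring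
  have hz0 : z = 0 := by
    rw [h2] at h1
    rw [real_inner_self_eq_norm_sq] at h1
    exact norm_eq_zero.1 (pow_eq_zero_iff (two_ne_zero) |>.1 (le_antisymm h1 (sq_nonneg _)))
  have hw : w = ⟪N, w⟫ • N := by rw [← sub_eq_zero]; exact hz0
  have hpos : 0 ≤ ⟪N, w⟫ := by
    have := h (-N) (by rw [inner_neg_right, hNN]; norm_num)
    rw [inner_neg_right, real_inner_comm] at this
    linarith
  have : ‖w‖ = ⟪N, w⟫ := by
    conv_lhs => rw [hw]
    rw [norm_smul, hN, Real.norm_of_nonneg hpos, mul_one]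
  rw [this]; exact hw

theorem IsC2DefiningAt.unitNormal_eq (h : IsC2DefiningAt Ω ρ y) (h' : IsC2DefiningAt Ω σ y) :
    unitNormal ρ y = unitNormal σ y := by
  have := eq_norm_smul_of_inner_neg_imp_nonpos (N := unitNormal σ y) (w := unitNormal ρ y)
    h'.norm_unitNormal ?_
  · rwa [h.norm_unitNormal, one_smul] at this
  intro v hv
  by_contra! hv'
  obtain ⟨s, h1, h2⟩ := ((h.eventually_mem hv').and (h'.eventually_notMem hv)).exists
  exact h2 h1

/-- The parabola `y + s Pv + s² c N` (`P` the tangential projection) avoids `Ω` for small `s`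
if `2 c` is less than the normal curvature in direction `v`. -/
theorem IsC2DefiningAt.eventually_curve_notMem (h : IsC2DefiningAt Ω ρ y)
    (v : EuclideanSpace ℝ (Fin n)) {c : ℝ} (hc : 2 * c < secondForm ρ y v v) :
    ∀ᶠ s in 𝓝 (0 : ℝ), y + s • (tangentHyperplane ρ y).starProjection v
      + s ^ 2 • (c • unitNormal ρ y) ∉ Ω := by
  set w := (tangentHyperplane ρ y).starProjection v with hw
  obtain ⟨h1, h2⟩ := hasDerivAt_comp_quadratic_curve h.contDiffAt w (c • unitNormal ρ y)
  have ha := h.norm_gradient_pos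
  have h3 := eventually_ge_of_second_deriv_pos h1 h2 ?_ ?_
  · have hγ := (hasDerivAt_quadratic_curve y w (c • unitNormal ρ y) 0).continuousAt.tendsto
    simp only [zero_smul, add_zero, ne_eq, OfNat.ofNat_ne_zero, not_false_eq_true, zero_pow,
      h.eq_zero] at hγ h3
    filter_upwards [hγ.eventually h.eventually_mem_iff, h3] with s hs hs'
    rw [hs, not_lt]
    exact hs'
  · simp [h.fderiv_apply, hw, h.inner_starProjection]
  · rw [h.fderiv_apply, real_inner_smul_right, real_inner_self_eq_norm_sq, h.norm_unitNormal]
    simp only [secondForm, smul_apply,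
      ContinuousLinearMap.bilinearComp_apply, smul_eq_mul, ← hw] at hc
    rw [lt_inv_mul_iff₀ ha] at hc
    linarith

theorem IsC2DefiningAt.eventually_curve_mem (h : IsC2DefiningAt Ω ρ y)
    (v : EuclideanSpace ℝ (Fin n)) {c : ℝ} (hc : secondForm ρ y v v < 2 * c) :
    ∃ᶠ s in 𝓝 (0 : ℝ), y + s • (tangentHyperplane ρ y).starProjection v
      + s ^ 2 • (c • unitNormal ρ y) ∈ Ω := by
  set w := (tangentHyperplane ρ y).starProjection v with hw
  obtain ⟨h1, h2⟩ := hasDerivAt_comp_quadratic_curve h.contDiffAt w (c • unitNormal ρ y)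
  have ha := h.norm_gradient_pos
  have hneg : fderiv ℝ (fderiv ℝ ρ) y w w + 2 * fderiv ℝ ρ y (c • unitNormal ρ y) < 0 := by
    rw [h.fderiv_apply, real_inner_smul_right, real_inner_self_eq_norm_sq, h.norm_unitNormal]
    simp only [secondForm, smul_apply,
      ContinuousLinearMap.bilinearComp_apply, smul_eq_mul, ← hw] at hc
    rw [inv_mul_lt_iff₀ ha] at hc
    linarith
  have h3 := eventually_ge_of_second_deriv_pos (h1.mono fun s hs => hs.neg) h2.neg
    (by simp [h.fderiv_apply, hw, h.inner_starProjection]) (neg_pos.2 hneg)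
  -- If the curve avoided `Ω` near `s = 0`, then `ρ ≥ 0` along it, while `h3` gives `ρ ≤ 0`; so `ρ`
  -- would vanish there, against the negative second derivative.
  intro hnot
  refine hneg.ne (second_deriv_eq_zero_of_eventually_eq h1 h2 ?_)
  have hγ := (hasDerivAt_quadratic_curve y w (c • unitNormal ρ y) 0).continuousAt.tendsto
  simp only [zero_smul, add_zero, ne_eq, OfNat.ofNat_ne_zero, not_false_eq_true, zero_pow,
    h.eq_zero, Pi.neg_apply] at hγ h3
  filter_upwards [hγ.eventually h.eventually_mem_iff, h3, hnot] with s hs hs' hs''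
  rw [hs, not_lt] at hs''
  simp [h.eq_zero]
  linarith

/-- Normal curvature is determined by which parabolas enter `Ω`. A `c` strictly between the two
values would give one parabola that both avoids and meets `Ω`. This independence of the defining
function matters because the mean curvature is defined through an arbitrary choice at each point. -/
theorem IsC2DefiningAt.secondForm_le (h : IsC2DefiningAt Ω ρ y) (h' : IsC2DefiningAt Ω σ y)
    (v : EuclideanSpace ℝ (Fin n)) : secondForm ρ y v v ≤ secondForm σ y v v := by
  by_contra! hlt
  obtain ⟨c, hc1, hc2⟩ := exists_between hlt
  have h1 := h.eventually_curve_notMem v (c := c / 2) (by linarith)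
  have h2 := h'.eventually_curve_mem v (c := c / 2) (by linarith)
  rw [h'.starProjection_apply, ← h.unitNormal_eq h'] at h2
  rw [h.starProjection_apply] at h1
  exact h2 h1

theorem abs_secondForm_le (ρ : EuclideanSpace ℝ (Fin n) → ℝ) (y v : EuclideanSpace ℝ (Fin n)) :
    |secondForm ρ y v v| ≤ ‖gradient ρ y‖⁻¹ * ‖fderiv ℝ (fderiv ℝ ρ) y‖ * ‖v‖ ^ 2 := by
  simp only [secondForm, smul_apply,
      ContinuousLinearMap.bilinearComp_apply, smul_eq_mul]
  set w := (tangentHyperplane ρ y).starProjection v with hw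
  have hwv : ‖w‖ ≤ ‖v‖ := Submodule.norm_starProjection_apply_le _ _
  have h1 : |fderiv ℝ (fderiv ℝ ρ) y w w| ≤ ‖fderiv ℝ (fderiv ℝ ρ) y‖ * ‖w‖ * ‖w‖ :=
    (fderiv ℝ (fderiv ℝ ρ) y).le_opNorm₂ w w
  rw [abs_mul, abs_of_nonneg (by positivity : 0 ≤ ‖gradient ρ y‖⁻¹), mul_assoc]
  refine mul_le_mul_of_nonneg_left (h1.trans ?_) (by positivity)
  rw [mul_assoc, ← sq]
  gcongr

/-- A local defining function at a boundary point is a local defining function at all nearby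
boundary points. -/
theorem IsC2DefiningAt.eventually (h : IsC2DefiningAt Ω ρ y) :
    ∀ᶠ z in 𝓝 y, z ∈ frontier Ω → z ∉ Ω → IsC2DefiningAt Ω ρ z := by
  have hg : ∀ᶠ z in 𝓝 y, gradient ρ z ≠ 0 := by
    have hc : ContinuousAt (fderiv ℝ ρ) y :=
      (h.contDiffAt.fderiv_right (m := 1) (by norm_num)).continuousAt
    have hc' : ContinuousAt (gradient ρ) y :=
      (InnerProductSpace.toDual ℝ _).symm.continuous.continuousAt.comp hc
    exact hc'.eventually_ne h.gradient_ne_zero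
  filter_upwards [hg, h.contDiffAt.eventually (by simp), h.eventually_mem_iff.eventually_nhds]
    with z h1 h2 h3 hz hz'
  refine ⟨h2, h1, le_antisymm ?_ ?_, h3⟩
  · have hcl : z ∈ closure Ω := frontier_subset_closure hz
    have hne : (𝓝[Ω] z).NeBot := mem_closure_iff_nhdsWithin_neBot.1 hcl
    refine le_of_tendsto (h2.continuousAt.tendsto.mono_left (nhdsWithin_le_nhds (s := Ω))) ?_
    filter_upwards [nhdsWithin_le_nhds h3, self_mem_nhdsWithin] with w hw hw'
    exact (hw.1 hw').le
  · rw [← not_lt, ← h3.self_of_nhds]; exact hz'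

end Geometry

/-! ### Curvature bounds and the trace of the shape operator -/

section Domain

variable {n : ℕ} {Ω : Set (EuclideanSpace ℝ (Fin n))} {ρ σ : EuclideanSpace ℝ (Fin n) → ℝ}
  {y : EuclideanSpace ℝ (Fin n)}

theorem notMem_of_mem_frontier (hΩ : IsOpen Ω) (hy : y ∈ frontier Ω) : y ∉ Ω := by
  rw [hΩ.frontier_eq] at hy; exact hy.2

/-- The principal curvatures of a compact `C²` boundary are bounded. -/
theorem exists_secondForm_bound (hΩ : IsOpen Ω) (hc : IsCompact (frontier Ω))
    (hC2 : HasC2Boundary Ω) :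
    ∃ K : ℝ, 0 ≤ K ∧ ∀ y ∈ frontier Ω, ∀ ρ : EuclideanSpace ℝ (Fin n) → ℝ,
      IsC2DefiningAt Ω ρ y → ∀ v, secondForm ρ y v v ≤ K * ‖v‖ ^ 2 := by
  -- The repeated membership hypothesis makes the predicate meaningful on arbitrary sets, as compact
  -- induction requires.
  suffices h : ∃ K : ℝ, 0 ≤ K ∧ ∀ y ∈ frontier Ω, y ∈ frontier Ω →
      ∀ ρ : EuclideanSpace ℝ (Fin n) → ℝ,
      IsC2DefiningAt Ω ρ y → ∀ v, secondForm ρ y v v ≤ K * ‖v‖ ^ 2 by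
    obtain ⟨K, hK, h⟩ := h
    exact ⟨K, hK, fun y hy => h y hy hy⟩
  refine hc.induction_on (p := fun s => ∃ K : ℝ, 0 ≤ K ∧ ∀ y ∈ s, y ∈ frontier Ω →
      ∀ ρ : EuclideanSpace ℝ (Fin n) → ℝ,
      IsC2DefiningAt Ω ρ y → ∀ v, secondForm ρ y v v ≤ K * ‖v‖ ^ 2) ?_ ?_ ?_ ?_
  · exact ⟨0, le_rfl, by simp⟩
  · rintro s t hst ⟨K, hK, h⟩
    exact ⟨K, hK, fun y hy => h y (hst hy)⟩
  · rintro s t ⟨K, hK, h⟩ ⟨L, hL, h'⟩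
    refine ⟨max K L, hK.trans (le_max_left _ _), ?_⟩
    rintro y (hy | hy) hyf ρ hρ v
    · exact (h y hy hyf ρ hρ v).trans (by gcongr; exact le_max_left _ _)
    · exact (h' y hy hyf ρ hρ v).trans (by gcongr; exact le_max_right _ _)
  · intro y hy
    obtain ⟨σ, hσ⟩ := hC2 y hy
    have h1 : ContinuousAt (fderiv ℝ σ) y :=
      (hσ.contDiffAt.fderiv_right (m := 1) (by norm_num)).continuousAt
    have h1' : ContinuousAt (gradient σ) y :=
      (InnerProductSpace.toDual ℝ _).symm.continuous.continuousAt.comp h1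
    have h2 : ContinuousAt (fderiv ℝ (fderiv ℝ σ)) y :=
      ((hσ.contDiffAt.fderiv_right (m := 1) (by norm_num)).fderiv_right (m := 0)
        (by norm_num)).continuousAt
    have h2' := ContinuousAt.norm
      (E := EuclideanSpace ℝ (Fin n) →L[ℝ] EuclideanSpace ℝ (Fin n) →L[ℝ] ℝ) h2
    have h3 : ContinuousAt (fun z => ‖gradient σ z‖⁻¹ * ‖fderiv ℝ (fderiv ℝ σ) z‖) y :=
      (h1'.norm.inv₀ (norm_ne_zero_iff.2 hσ.gradient_ne_zero)).mul h2'
    set K := ‖gradient σ y‖⁻¹ * ‖fderiv ℝ (fderiv ℝ σ) y‖ + 1 with hK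
    have h4 : ∀ᶠ z in 𝓝 y, ‖gradient σ z‖⁻¹ * ‖fderiv ℝ (fderiv ℝ σ) z‖ < K :=
      h3.tendsto.eventually (gt_mem_nhds (by rw [hK]; linarith))
    refine ⟨_, nhdsWithin_le_nhds (h4.and hσ.eventually), K, by positivity, ?_⟩
    rintro z ⟨hz1, hz2⟩ hzf ρ hρ v
    have hz := hz2 hzf (notMem_of_mem_frontier hΩ hzf)
    refine (hρ.secondForm_le hz v).trans ((le_abs_self _).trans
      ((abs_secondForm_le σ z v).trans ?_))
    gcongr

theorem hasFDerivAt_gradient {f : EuclideanSpace ℝ (Fin n) → ℝ} (hf : ContDiffAt ℝ 2 f y) :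
    ∃ G : EuclideanSpace ℝ (Fin n) →L[ℝ] EuclideanSpace ℝ (Fin n),
      HasFDerivAt (gradient f) G y ∧ ∀ v w, ⟪G v, w⟫ = fderiv ℝ (fderiv ℝ f) y v w := by
  have hd : DifferentiableAt ℝ (fderiv ℝ f) y :=
    (hf.fderiv_right (m := 1) (by norm_num)).differentiableAt (by simp)
  let T : (EuclideanSpace ℝ (Fin n) →L[ℝ] ℝ) →L[ℝ] EuclideanSpace ℝ (Fin n) :=
    { toFun := (InnerProductSpace.toDual ℝ (EuclideanSpace ℝ (Fin n))).symm
      map_add' := fun a b => map_add _ a b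
      map_smul' := fun c a => by simp
      cont := (InnerProductSpace.toDual ℝ (EuclideanSpace ℝ (Fin n))).symm.continuous }
  refine ⟨T ∘L fderiv ℝ (fderiv ℝ f) y, T.hasFDerivAt.comp y hd.hasFDerivAt, fun v w => ?_⟩
  exact InnerProductSpace.toDual_symm_apply

/-- Cyclicity of the trace moves the computation to the ambient space. Differentiating the factor
`‖∇ρ‖⁻¹` in the normal only produces a multiple of `∇ρ`, which the tangential projection kills. -/
theorem IsC2DefiningAt.trace_weingarten (h : IsC2DefiningAt Ω ρ y) :
    LinearMap.trace ℝ _ (weingarten ρ y) = ∑ i : Fin n,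
      secondForm ρ y (EuclideanSpace.single i 1) (EuclideanSpace.single i 1) := by
  set P := (tangentHyperplane ρ y).starProjection with hP
  set π : EuclideanSpace ℝ (Fin n) →ₗ[ℝ] tangentHyperplane ρ y :=
    ((tangentHyperplane ρ y).orthogonalProjectionOnto : _ →L[ℝ] tangentHyperplane ρ y).toLinearMap
    with hπ
  set ι := (tangentHyperplane ρ y).subtype with hι
  set A := (fderiv ℝ (unitNormal ρ) y).toLinearMap with hA
  have hPP : ∀ v, ι (π v) = P v := fun v => rfl
  have hπι : ∀ v, π (ι v) = v := fun v =>
    Submodule.orthogonalProjectionOnto_mem_subspace_eq_self v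
  have h1 : weingarten ρ y = π ∘ₗ (-(ι ∘ₗ π ∘ₗ A ∘ₗ ι)) := by
    ext1 v
    simp only [weingarten, LinearMap.neg_apply, LinearMap.comp_apply, map_neg, hπι]
    rfl
  have hinner : ∀ v w, ⟪A v, P w⟫ = -(‖gradient ρ y‖⁻¹ * fderiv ℝ (fderiv ℝ ρ) y v (P w)) := by
    intro v w
    obtain ⟨G, hG, hG'⟩ := hasFDerivAt_gradient h.contDiffAt
    have hd : DifferentiableAt ℝ (fun x => ‖gradient ρ x‖⁻¹) y :=
      (hG.differentiableAt.norm ℝ h.gradient_ne_zero).inv (norm_ne_zero_iff.2 h.gradient_ne_zero)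
    have hN : HasFDerivAt (unitNormal ρ) _ y := (hd.hasFDerivAt.fun_smul hG).fun_neg
    have hort : ⟪gradient ρ y, P w⟫ = 0 := by
      have h2 := h.inner_starProjection w
      rw [unitNormal, inner_neg_left, real_inner_smul_left, neg_eq_zero, mul_eq_zero] at h2
      exact h2.resolve_left (inv_ne_zero (norm_ne_zero_iff.2 h.gradient_ne_zero))
    rw [hA, hN.fderiv]
    simp only [ContinuousLinearMap.coe_coe, neg_apply, add_apply, smul_apply,
      ContinuousLinearMap.smulRight_apply, inner_neg_left, inner_add_left, real_inner_smul_left,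
      hort, hG', mul_zero, add_zero]
  rw [h1, LinearMap.trace_comp_comm',
    LinearMap.trace_eq_sum_inner _ (EuclideanSpace.basisFun (Fin n) ℝ)]
  refine Finset.sum_congr rfl fun i _ => ?_
  simp only [EuclideanSpace.basisFun_apply, LinearMap.comp_apply, LinearMap.neg_apply,
    inner_neg_right, hPP]
  rw [hP, ← Submodule.inner_starProjection_left_eq_right, ← hP, real_inner_comm, hinner]
  simp [secondForm, ← hP]

theorem exists_isC2DefiningAt_trace (hn : 2 ≤ n) (hC2 : HasC2Boundary Ω) (hy : y ∈ frontier Ω) :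
    ∃ ρ : EuclideanSpace ℝ (Fin n) → ℝ, IsC2DefiningAt Ω ρ y ∧
      ((n : ℝ) - 1) * boundaryMeanCurvature Ω y = ∑ i : Fin n,
        secondForm ρ y (EuclideanSpace.single i 1) (EuclideanSpace.single i 1) := by
  have h := hC2 y hy
  refine ⟨Classical.choose h, Classical.choose_spec h, ?_⟩
  rw [← (Classical.choose_spec h).trace_weingarten, boundaryMeanCurvature, dif_pos h]
  have : (2 : ℝ) ≤ n := by exact_mod_cast hn
  field_simp [show (n : ℝ) - 1 ≠ 0 by linarith]

/-! ### The distance to the complement -/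

theorem exists_nearest_frontier (hΩ : IsOpen Ω) (hne : Ωᶜ.Nonempty)
    {x : EuclideanSpace ℝ (Fin n)} (hx : x ∈ Ω) :
    ∃ y ∈ frontier Ω, dist x y = Metric.infDist x Ωᶜ ∧ 0 < Metric.infDist x Ωᶜ ∧
      Metric.ball x (Metric.infDist x Ωᶜ) ⊆ Ω ∧
      y ∈ closure (Metric.ball x (Metric.infDist x Ωᶜ)) := by
  obtain ⟨y, hy, hxy⟩ := hΩ.isClosed_compl.exists_infDist_eq_dist hne x
  have hpos : 0 < Metric.infDist x Ωᶜ :=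
    (hΩ.isClosed_compl.notMem_iff_infDist_pos hne).1 (by simpa using hx)
  have hball : Metric.ball x (Metric.infDist x Ωᶜ) ⊆ Ω := by
    simpa using Metric.ball_infDist_compl_subset (s := Ω) (x := x)
  have hycl : y ∈ closure (Metric.ball x (Metric.infDist x Ωᶜ)) := by
    rw [closure_ball x hpos.ne', Metric.mem_closedBall, dist_comm, hxy]
  refine ⟨y, ?_, hxy.symm, hpos, hball, hycl⟩
  rw [hΩ.frontier_eq]
  exact ⟨closure_mono hball hycl, hy⟩

/-- The segment from an interior point to a nearest boundary point is normal to the boundary. -/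
theorem IsC2DefiningAt.eq_add_normal (h : IsC2DefiningAt Ω ρ y) {x : EuclideanSpace ℝ (Fin n)}
    (hxy : dist x y = Metric.infDist x Ωᶜ) :
    x = y + Metric.infDist x Ωᶜ • unitNormal ρ y := by
  have key := eq_norm_smul_of_inner_neg_imp_nonpos (N := unitNormal ρ y) (w := x - y) h.norm_unitNormal ?_
  · rw [← dist_eq_norm, hxy] at key
    rw [← key]; abel
  -- Moving `y` outward stays in the complement, so the squared distance to `x` cannot decrease; its
  -- one-sided derivative is nonnegative.
  intro v hv
  have hd : HasDerivAt (fun s : ℝ => ‖(y - x) + s • v‖ ^ 2) (2 * ⟪y - x, v⟫) 0 := by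
    have := (((hasDerivAt_id (0 : ℝ)).smul_const v).const_add (y - x)).norm_sq
    simpa using this
  have hs := (hasDerivAt_iff_tendsto_slope_zero.1 hd).mono_left
    (nhdsWithin_mono 0 (fun s (hs : s ∈ Ioi (0 : ℝ)) => ne_of_gt (mem_Ioi.1 hs)))
  have h0 : 0 ≤ 2 * ⟪y - x, v⟫ := by
    refine ge_of_tendsto hs ?_
    filter_upwards [h.eventually_notMem hv, self_mem_nhdsWithin] with s h1 h2
    have h2' : (0 : ℝ) < s := h2
    have h3 : ‖y - x‖ ≤ ‖(y - x) + s • v‖ := by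
      calc ‖y - x‖ = Metric.infDist x Ωᶜ := by rw [← hxy, dist_comm, dist_eq_norm]
        _ ≤ dist x (y + s • v) := Metric.infDist_le_dist_of_mem h1
        _ = _ := by rw [dist_comm, dist_eq_norm]; congr 1; abel
    simp only [zero_add, zero_smul, add_zero, smul_eq_mul]
    have : ‖y - x‖ ^ 2 ≤ ‖(y - x) + s • v‖ ^ 2 := by gcongr
    exact mul_nonneg (inv_nonneg.2 h2'.le) (by linarith)
  have : ⟪x - y, v⟫ = -⟪y - x, v⟫ := by rw [← inner_neg_left]; simp
  linarith

/-- Semiconcavity of the distance function: along each line it is touched from above by a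
parabola whose opening is governed by the curvature of the boundary at a nearest point. -/
theorem IsC2DefiningAt.infDist_le_parabola (h : IsC2DefiningAt Ω ρ y)
    {x : EuclideanSpace ℝ (Fin n)} (hxy : dist x y = Metric.infDist x Ωᶜ)
    (hpos : 0 < Metric.infDist x Ωᶜ) (v : EuclideanSpace ℝ (Fin n)) {c : ℝ}
    (hc : -secondForm ρ y v v < 2 * c) :
    ∀ᶠ s in 𝓝 (0 : ℝ), Metric.infDist (x + s • v) Ωᶜ ≤
      Metric.infDist x Ωᶜ + s * ⟪unitNormal ρ y, v⟫ + s ^ 2 * c := by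
  set d := Metric.infDist x Ωᶜ with hd
  set N := unitNormal ρ y with hN
  have hx := h.eq_add_normal hxy
  have h1 := h.eventually_curve_notMem v (c := -c) (by linarith)
  have h2 : ∀ᶠ s in 𝓝 (0 : ℝ), 0 < d + s * ⟪N, v⟫ + s ^ 2 * c := by
    have : Continuous (fun s : ℝ => d + s * ⟪N, v⟫ + s ^ 2 * c) := by fun_prop
    refine (this.tendsto 0).eventually (lt_mem_nhds ?_)
    simpa using hpos
  filter_upwards [h1, h2] with s hs1 hs2
  rw [h.starProjection_apply, ← hN] at hs1
  -- This point is the curve `y + s Pv - s² c N`, which avoids `Ω`. Its distance from `x + s v` is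
  -- exactly the value of the parabola.
  have hmem : x + s • v - (d + s * ⟪N, v⟫ + s ^ 2 * c) • N ∈ Ωᶜ := by
    have : x + s • v - (d + s * ⟪N, v⟫ + s ^ 2 * c) • N
        = y + s • (v - ⟪N, v⟫ • N) + s ^ 2 • -c • N := by
      rw [hx, ← hd, ← hN]; module
    rw [this]; exact hs1
  refine (Metric.infDist_le_dist_of_mem hmem).trans ?_
  rw [dist_eq_norm, sub_sub_cancel, norm_smul, h.norm_unitNormal, mul_one,
    Real.norm_of_nonneg hs2.le]

end Domain

/-! ### The mean curvature operator in nondivergence form -/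

section Operator

variable {n : ℕ}

/-- The operator `∑ aⁱʲ(p) Bᵢⱼ` with `aⁱʲ(p) = (1 + ‖p‖²) δᵢⱼ - pᵢ pⱼ`. -/
def mcForm (p : EuclideanSpace ℝ (Fin n))
    (B : EuclideanSpace ℝ (Fin n) →L[ℝ] EuclideanSpace ℝ (Fin n) →L[ℝ] ℝ) : ℝ :=
  (1 + ‖p‖ ^ 2) * ∑ i : Fin n, B (EuclideanSpace.single i 1) (EuclideanSpace.single i 1) - B p p

theorem sum_smul_single (p : EuclideanSpace ℝ (Fin n)) :
    ∑ i, p i • EuclideanSpace.single i (1 : ℝ) = p := by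
  simpa using (EuclideanSpace.basisFun (Fin n) ℝ).sum_repr p

theorem apply_self_eq_sum (p : EuclideanSpace ℝ (Fin n))
    (B : EuclideanSpace ℝ (Fin n) →L[ℝ] EuclideanSpace ℝ (Fin n) →L[ℝ] ℝ) :
    B p p = ∑ i, ∑ j, p i * p j * B (EuclideanSpace.single i 1) (EuclideanSpace.single j 1) := by
  conv_lhs => rw [← sum_smul_single p]
  simp only [map_sum, map_smul, sum_apply, smul_apply, smul_eq_mul, Finset.mul_sum]
  rw [Finset.sum_comm]
  refine Finset.sum_congr rfl fun i _ => Finset.sum_congr rfl fun j _ => by ring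

/-- Ellipticity, by Lagrange's identity: `‖p‖² tr B - B(p, p)` is half the sum of `B` on the vectors
`pᵢ eⱼ - pⱼ eᵢ`. Neither symmetry nor diagonalization of `B` is needed. -/
theorem mcForm_nonneg (p : EuclideanSpace ℝ (Fin n))
    {B : EuclideanSpace ℝ (Fin n) →L[ℝ] EuclideanSpace ℝ (Fin n) →L[ℝ] ℝ}
    (hB : ∀ v, 0 ≤ B v v) : 0 ≤ mcForm p B := by
  let e : Fin n → EuclideanSpace ℝ (Fin n) := fun i => EuclideanSpace.single i 1
  have h1 : 0 ≤ ∑ i, ∑ j, B (p i • e j - p j • e i) (p i • e j - p j • e i) :=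
    Finset.sum_nonneg fun i _ => Finset.sum_nonneg fun j _ => hB _
  have h2 : ∑ i, ∑ j, B (p i • e j - p j • e i) (p i • e j - p j • e i)
      = 2 * (‖p‖ ^ 2 * ∑ i, B (e i) (e i) - B p p) := by
    have h3 : ∀ i j, B (p i • e j - p j • e i) (p i • e j - p j • e i)
        = p i ^ 2 * B (e j) (e j) + p j ^ 2 * B (e i) (e i)
          - p i * p j * B (e i) (e j) - p j * p i * B (e j) (e i) := by
      intro i j
      simp only [map_sub, map_smul, sub_apply, smul_apply, smul_eq_mul]
      ring
    simp_rw [h3, Finset.sum_sub_distrib, Finset.sum_add_distrib]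
    rw [Finset.sum_comm (f := fun i j => p j ^ 2 * B (e i) (e i)),
      Finset.sum_comm (f := fun i j => p j * p i * B (e j) (e i)),
      apply_self_eq_sum, EuclideanSpace.norm_sq_eq, Finset.sum_mul_sum]
    simp only [Real.norm_eq_abs, sq_abs]
    ring
  have h4 : 0 ≤ ∑ i, B (e i) (e i) := Finset.sum_nonneg fun i _ => hB _
  have h5 : mcForm p B = ∑ i, B (e i) (e i) + (‖p‖ ^ 2 * ∑ i, B (e i) (e i) - B p p) := by
    simp only [mcForm, e]; ring
  rw [h5]
  linarith

theorem mcForm_sub (p : EuclideanSpace ℝ (Fin n))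
    (B B' : EuclideanSpace ℝ (Fin n) →L[ℝ] EuclideanSpace ℝ (Fin n) →L[ℝ] ℝ) :
    mcForm p (B - B') = mcForm p B - mcForm p B' := by
  simp only [mcForm, sub_apply, Finset.sum_sub_distrib]; ring

theorem mcForm_neg (p : EuclideanSpace ℝ (Fin n))
    (B : EuclideanSpace ℝ (Fin n) →L[ℝ] EuclideanSpace ℝ (Fin n) →L[ℝ] ℝ) :
    mcForm (-p) (-B) = -mcForm p B := by
  simp only [mcForm, neg_apply, Finset.sum_neg_distrib, norm_neg, map_neg]; ring

/-- Differentiating the factor `W⁻¹` contributes `-W⁻³ D²u(p, p)`; multiplying by `W³` leaves the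
polynomial operator. -/
theorem divergence_eq_mcForm {u : EuclideanSpace ℝ (Fin n) → ℝ} {x : EuclideanSpace ℝ (Fin n)}
    (hu : ContDiffAt ℝ 2 u x) :
    divergence (fun z => (Real.sqrt (1 + ‖gradient u z‖ ^ 2))⁻¹ • gradient u z) x
      * Real.sqrt (1 + ‖gradient u x‖ ^ 2) ^ 3
      = mcForm (gradient u x) (fderiv ℝ (fderiv ℝ u) x) := by
  obtain ⟨G, hG, hG'⟩ := hasFDerivAt_gradient hu
  set p := gradient u x with hp
  have hpos : 0 < 1 + ‖p‖ ^ 2 := by positivity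
  set W := Real.sqrt (1 + ‖p‖ ^ 2) with hW
  have hWpos : 0 < W := Real.sqrt_pos.2 hpos
  have hW2 : W ^ 2 = 1 + ‖p‖ ^ 2 := Real.sq_sqrt hpos.le
  have h1 : HasFDerivAt (fun z => 1 + ‖gradient u z‖ ^ 2) (2 • (innerSL ℝ p) ∘L G) x := by
    simpa [hp] using hG.norm_sq.const_add 1
  have h2 := (hasDerivAt_inv hWpos.ne').comp_hasFDerivAt x (h1.sqrt hpos.ne')
  have h3 := h2.fun_smul hG
  have h4 : ∀ v : EuclideanSpace ℝ (Fin n), fderiv ℝ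
      (fun z => (Real.sqrt (1 + ‖gradient u z‖ ^ 2))⁻¹ • gradient u z) x v
      = W⁻¹ • G v - (W⁻¹ ^ 3 * ⟪p, G v⟫) • p := by
    intro v
    rw [show fderiv ℝ (fun z => (Real.sqrt (1 + ‖gradient u z‖ ^ 2))⁻¹ • gradient u z) x = _ from
      h3.fderiv]
    simp only [Function.comp_apply, add_apply, smul_apply, ContinuousLinearMap.smulRight_apply,
      ← hp, ← hW, ContinuousLinearMap.comp_apply, innerSL_apply_apply, smul_eq_mul, nsmul_eq_mul]
    rw [sub_eq_add_neg, ← neg_smul]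
    congr 2
    field_simp
    norm_num
  have h5 : ∀ v i, (G v) i = fderiv ℝ (fderiv ℝ u) x v (EuclideanSpace.single i 1) := by
    intro v i
    rw [← hG', EuclideanSpace.inner_single_right]; simp
  have h6 : ∑ i : Fin n, ⟪p, G (EuclideanSpace.single i 1)⟫ * p i
      = fderiv ℝ (fderiv ℝ u) x p p := by
    have : ∀ i : Fin n, ⟪p, G (EuclideanSpace.single i 1)⟫ * p i
        = fderiv ℝ (fderiv ℝ u) x (p i • EuclideanSpace.single i 1) p := by
      intro i
      rw [real_inner_comm, hG', map_smul, smul_apply, smul_eq_mul, mul_comm]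
    simp_rw [this]
    rw [← sum_apply, ← map_sum, sum_smul_single]
  simp only [divergence, h4, PiLp.sub_apply, PiLp.smul_apply, smul_eq_mul, h5,
    Finset.sum_sub_distrib, mcForm]
  rw [← Finset.mul_sum]
  simp_rw [mul_assoc]
  rw [← Finset.mul_sum, h6, ← hW2]
  field_simp

end Operator

/-! ### Linearity of second derivatives -/

section SecondDerivatives

variable {E : Type*} [NormedAddCommGroup E] [NormedSpace ℝ E]

theorem fderiv_fderiv_sub {f g : E → ℝ} {x : E} (hf : ContDiffAt ℝ 2 f x)
    (hg : ContDiffAt ℝ 2 g x) :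
    fderiv ℝ (fderiv ℝ (f - g)) x = fderiv ℝ (fderiv ℝ f) x - fderiv ℝ (fderiv ℝ g) x := by
  have h : fderiv ℝ (f - g) =ᶠ[𝓝 x] fderiv ℝ f - fderiv ℝ g := by
    filter_upwards [hf.eventually (by simp), hg.eventually (by simp)] with z hz hz'
    exact fderiv_sub (hz.differentiableAt (by simp)) (hz'.differentiableAt (by simp))
  rw [h.fderiv_eq, fderiv_sub ((hf.fderiv_right (m := 1) (by norm_num)).differentiableAt (by simp))
    ((hg.fderiv_right (m := 1) (by norm_num)).differentiableAt (by simp))]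

theorem fderiv_fderiv_neg (f : E → ℝ) (x : E) :
    fderiv ℝ (fderiv ℝ (-f)) x = -fderiv ℝ (fderiv ℝ f) x := by
  have h : fderiv ℝ (-f) = -fderiv ℝ f := by ext1 z; exact fderiv_neg
  rw [h]; exact fderiv_neg

theorem norm_fderiv_fderiv_neg (f : E → ℝ) (x : E) :
    ‖fderiv ℝ (fderiv ℝ (-f)) x‖ = ‖fderiv ℝ (fderiv ℝ f) x‖ := by
  rw [fderiv_fderiv_neg]; exact norm_neg (fderiv ℝ (fderiv ℝ f) x)

end SecondDerivatives

/-! ### The pointwise supersolution inequality -/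

section PointwiseEstimate

variable {n : ℕ}

theorem apply_self_le {E : Type*} [NormedAddCommGroup E] [NormedSpace ℝ E] {C : ℝ}
    {B : E →L[ℝ] E →L[ℝ] ℝ} (hB : ‖B‖ ≤ C) (v : E) : |B v v| ≤ C * ‖v‖ ^ 2 := by
  refine (B.le_opNorm₂ v v).trans ?_
  rw [mul_assoc, ← sq]
  gcongr

theorem mcForm_le_of_norm_le (p : EuclideanSpace ℝ (Fin n)) {C : ℝ} (hC : 0 ≤ C)
    {B : EuclideanSpace ℝ (Fin n) →L[ℝ] EuclideanSpace ℝ (Fin n) →L[ℝ] ℝ} (hB : ‖B‖ ≤ C) :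
    mcForm p B ≤ (n + 1) * (1 + ‖p‖ ^ 2) * C := by
  have h1 : ∑ i : Fin n, B (EuclideanSpace.single i 1) (EuclideanSpace.single i 1) ≤ n * C := by
    have : ∀ i ∈ (Finset.univ : Finset (Fin n)),
        B (EuclideanSpace.single i 1) (EuclideanSpace.single i 1) ≤ C := by
      intro i _
      simpa using (le_abs_self _).trans (apply_self_le hB (EuclideanSpace.single i (1 : ℝ)))
    simpa using Finset.sum_le_card_nsmul _ _ _ this
  have h2 := neg_le_of_abs_le (apply_self_le hB p)
  have h3 : 0 ≤ 1 + ‖p‖ ^ 2 := by positivity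
  rw [mcForm]
  nlinarith [mul_le_mul_of_nonneg_left h1 h3]

/-- The rank-one form `v ↦ ⟪N, v⟫²`. -/
def rankOneForm (N : EuclideanSpace ℝ (Fin n)) :
    EuclideanSpace ℝ (Fin n) →L[ℝ] EuclideanSpace ℝ (Fin n) →L[ℝ] ℝ :=
  (innerSL ℝ N).smulRight (innerSL ℝ N)

theorem rankOneForm_apply (N v w : EuclideanSpace ℝ (Fin n)) :
    rankOneForm N v w = ⟪N, v⟫ * ⟪N, w⟫ := by
  simp [rankOneForm]

/-- By Cauchy–Schwarz the coefficient matrix has all eigenvalues at least `1`. This is the only gain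
available from the concavity of `ψ`, so every error must be reduced to order `t²`. -/
theorem one_le_mcForm_rankOneForm (p : EuclideanSpace ℝ (Fin n)) {N : EuclideanSpace ℝ (Fin n)}
    (hN : ‖N‖ = 1) : 1 ≤ mcForm p (rankOneForm N) := by
  have h1 : ∑ i : Fin n, rankOneForm N (EuclideanSpace.single i 1) (EuclideanSpace.single i 1)
      = 1 := by
    have h2 : ‖N‖ ^ 2 = 1 := by rw [hN]; norm_num
    refine Eq.trans ?_ h2
    rw [EuclideanSpace.norm_sq_eq]
    refine Finset.sum_congr rfl fun i _ => ?_
    rw [rankOneForm_apply, EuclideanSpace.inner_single_right]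
    simp [sq]
  have h3 : ⟪N, p⟫ ^ 2 ≤ ‖p‖ ^ 2 := by
    have := abs_real_inner_le_norm N p
    rw [hN, one_mul] at this
    rw [← sq_abs]; gcongr
  rw [mcForm, h1, rankOneForm_apply]
  nlinarith

/-- The arithmetic of the barrier inequality. -/
theorem barrier_arithmetic {m A B K h d t g W ν : ℝ} (hm : 0 ≤ m) (hA : 0 ≤ A) (hB : 0 ≤ B)
    (hK : 0 ≤ K) (hh : 0 ≤ h) (hd : 0 ≤ d) (ht : 1 ≤ t) (htd : t * d ≤ 1) (hg : 0 ≤ g)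
    (hgh : g ≤ m * h) (hW : 0 ≤ W) (hWt : W ≤ 1 + A + t)
    (hν : 4 * (m + 1) * (1 + A) ^ 2 * B + K * A ^ 2 + 12 * m * h * (1 + A) ^ 3 < ν) :
    (m + 1) * W ^ 2 * B - ν * t ^ 2 - t * W ^ 2 * g + t * (K * A ^ 2)
      < -(g + m * h * d) * W ^ 3 := by
  have hW' : W ≤ 2 * (1 + A) * t := by nlinarith
  have hW2 : W ^ 2 ≤ 4 * (1 + A) ^ 2 * t ^ 2 := by
    calc W ^ 2 ≤ (2 * (1 + A) * t) ^ 2 := by gcongr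
      _ = _ := by ring
  have hW3 : W ^ 3 ≤ 8 * (1 + A) ^ 3 * t ^ 3 := by
    calc W ^ 3 ≤ (2 * (1 + A) * t) ^ 3 := by gcongr
      _ = _ := by ring
  have e1 : (m + 1) * W ^ 2 * B ≤ (m + 1) * (4 * (1 + A) ^ 2 * t ^ 2) * B := by gcongr
  -- The cubic terms cancel here: the curvature supplies `g W² t` against the required `g W³`, and
  -- `W - t ≤ 1 + A`.
  have e2 : g * W ^ 2 * (W - t) ≤ (m * h) * (4 * (1 + A) ^ 2 * t ^ 2) * (1 + A) :=
    calc g * W ^ 2 * (W - t) ≤ g * W ^ 2 * (1 + A) :=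
          mul_le_mul_of_nonneg_left (by linarith) (by positivity)
      _ ≤ _ := by gcongr
  -- The bound `t d ≤ 1` trades one power of `t` for the distance.
  have e3 : m * h * d * W ^ 3 ≤ m * h * (8 * (1 + A) ^ 3 * t ^ 2) :=
    calc m * h * d * W ^ 3 ≤ m * h * d * (8 * (1 + A) ^ 3 * t ^ 3) := by gcongr
      _ = m * h * (8 * (1 + A) ^ 3 * t ^ 2) * (t * d) := by ring
      _ ≤ m * h * (8 * (1 + A) ^ 3 * t ^ 2) * 1 := by gcongr
      _ = _ := by ring
  have e4 : t * (K * A ^ 2) ≤ t ^ 2 * (K * A ^ 2) := by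
    have : t ≤ t ^ 2 := by nlinarith
    gcongr
  have e5 : (4 * (m + 1) * (1 + A) ^ 2 * B + K * A ^ 2 + 12 * m * h * (1 + A) ^ 3) * t ^ 2
      < ν * t ^ 2 := by gcongr
  linear_combination e1 + e2 + e3 + e4 + e5

/-- The upper barrier is a strict supersolution at a point of touching. -/
theorem mcForm_barrier_lt {ξ N : EuclideanSpace ℝ (Fin n)} {A B K h d t g ν : ℝ}
    {S Φ Q : EuclideanSpace ℝ (Fin n) →L[ℝ] EuclideanSpace ℝ (Fin n) →L[ℝ] ℝ}
    (hK : 0 ≤ K) (hh : 0 ≤ h) (hd : 0 ≤ d)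
    (ht : 1 ≤ t) (htd : t * d ≤ 1) (hg : 0 ≤ g) (hgh : g ≤ n * h)
    (hν : 4 * (n + 1) * (1 + A) ^ 2 * B + K * A ^ 2 + 12 * n * h * (1 + A) ^ 3 < ν)
    (hN : ‖N‖ = 1) (hξ : ‖ξ‖ ≤ A) (hΦ : ‖Φ‖ ≤ B)
    (hQN : ∀ v, Q N v = 0 ∧ Q v N = 0) (hQ : ∀ v, Q v v ≤ K * ‖v‖ ^ 2)
    (hQg : g ≤ ∑ i : Fin n, Q (EuclideanSpace.single i 1) (EuclideanSpace.single i 1))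
    (hS : ∀ v, S v v ≤ Φ v v - ν * t ^ 2 * ⟪N, v⟫ ^ 2 - t * Q v v) :
    mcForm (ξ + t • N) S < -(g + n * h * d) * Real.sqrt (1 + ‖ξ + t • N‖ ^ 2) ^ 3 := by
  set p := ξ + t • N with hp
  set W := Real.sqrt (1 + ‖p‖ ^ 2) with hW
  have hA : 0 ≤ A := (norm_nonneg _).trans hξ
  have hB : 0 ≤ B := (norm_nonneg Φ).trans hΦ
  have hW0 : 0 ≤ W := Real.sqrt_nonneg _
  have hW2 : W ^ 2 = 1 + ‖p‖ ^ 2 := Real.sq_sqrt (by positivity)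
  have hpt : ‖p‖ ≤ A + t := by
    refine (norm_add_le _ _).trans (add_le_add hξ ?_)
    rw [norm_smul, hN, mul_one, Real.norm_of_nonneg (by linarith)]
  have hWt : W ≤ 1 + A + t := by
    refine (Real.sqrt_le_left (by positivity)).2 ?_
    nlinarith [norm_nonneg p]
  have h1 : 0 ≤ mcForm p ((Φ - (ν * t ^ 2) • rankOneForm N - t • Q) - S) := by
    refine mcForm_nonneg p fun v => ?_
    have := hS v
    simp only [sub_apply, smul_apply, smul_eq_mul, rankOneForm_apply]
    nlinarith
  have h2 : ∀ (c : ℝ) (T : EuclideanSpace ℝ (Fin n) →L[ℝ] EuclideanSpace ℝ (Fin n) →L[ℝ] ℝ),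
      mcForm p (c • T) = c * mcForm p T := by
    intro c T
    simp only [mcForm, smul_apply, smul_eq_mul, ← Finset.mul_sum]
    ring
  rw [mcForm_sub, mcForm_sub, mcForm_sub, h2, h2] at h1
  have h3 := mcForm_le_of_norm_le p hB hΦ
  have hν0 : 0 ≤ ν := le_trans (by positivity) hν.le
  have h4 : ν * t ^ 2 ≤ ν * t ^ 2 * mcForm p (rankOneForm N) :=
    le_mul_of_one_le_right (by positivity) (one_le_mcForm_rankOneForm p hN)
  have h5 : W ^ 2 * g - K * A ^ 2 ≤ mcForm p Q := by
    -- `Q` annihilates `N`, so the large component `t N` of `p` drops out.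
    have h6 : Q p p = Q ξ ξ := by
      simp [hp, (hQN ξ).1, (hQN ξ).2, (hQN N).1]
    have h7 : Q p p ≤ K * A ^ 2 := by
      rw [h6]; exact (hQ ξ).trans (by gcongr)
    rw [mcForm, ← hW2]
    nlinarith [mul_le_mul_of_nonneg_left hQg (sq_nonneg W)]
  have h6 := barrier_arithmetic (m := n) (by positivity) hA hB hK hh hd ht htd hg hgh hW0 hWt hν
  rw [← hW2] at h3
  nlinarith [mul_le_mul_of_nonneg_left h5 (by linarith : 0 ≤ t)]

end PointwiseEstimate

/-! ### The comparison with the logarithmic barrier -/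

section Barrier

variable {n : ℕ} {Ω : Set (EuclideanSpace ℝ (Fin n))}

/-- The one-sided barrier estimate. -/
theorem sub_le_barrier (hn : 2 ≤ n) (hΩ : IsOpen Ω) (hb : Bornology.IsBounded Ω)
    (hC2 : HasC2Boundary Ω) (hne : Ωᶜ.Nonempty) {K : ℝ} (hK0 : 0 ≤ K)
    (hK : ∀ y ∈ frontier Ω, ∀ ρ : EuclideanSpace ℝ (Fin n) → ℝ,
      IsC2DefiningAt Ω ρ y → ∀ v, secondForm ρ y v v ≤ K * ‖v‖ ^ 2)
    {u φ G : EuclideanSpace ℝ (Fin n) → ℝ} {A B h M ν : ℝ} (hh : 0 ≤ h)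
    (hu : ContDiffOn ℝ 2 u Ω) (hφ : ContDiffOn ℝ 2 φ Ω)
    (huc : ContinuousOn u (closure Ω)) (hφc : ContinuousOn φ (closure Ω))
    (hφA : ∀ x ∈ Ω, ‖fderiv ℝ φ x‖ ≤ A) (hφB : ∀ x ∈ Ω, ‖fderiv ℝ (fderiv ℝ φ) x‖ ≤ B)
    (hM : ∀ x ∈ Ω, u x - φ x ≤ M) (hbd : ∀ y ∈ frontier Ω, u y = φ y)
    (hG0 : ∀ y ∈ frontier Ω, 0 ≤ G y) (hGh : ∀ y ∈ frontier Ω, G y ≤ n * h)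
    (hGS : ∀ y ∈ frontier Ω, G y ≤ ((n : ℝ) - 1) * boundaryMeanCurvature Ω y)
    (heq : ∀ x ∈ Ω, ∀ y ∈ frontier Ω, dist x y = Metric.infDist x Ωᶜ →
      Metric.ball x (Metric.infDist x Ωᶜ) ⊆ Ω → y ∈ closure (Metric.ball x (Metric.infDist x Ωᶜ)) →
      -(G y + n * h * Metric.infDist x Ωᶜ) * Real.sqrt (1 + ‖gradient u x‖ ^ 2) ^ 3
        ≤ mcForm (gradient u x) (fderiv ℝ (fderiv ℝ u) x))
    (hν1 : 1 ≤ ν)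
    (hν : 4 * (n + 1) * (1 + A) ^ 2 * B + K * A ^ 2 + 12 * n * h * (1 + A) ^ 3 < ν) :
    ∀ x ∈ closure Ω, u x - φ x ≤ Real.exp (ν * M) * Metric.infDist x Ωᶜ := by
  set d : EuclideanSpace ℝ (Fin n) → ℝ := fun x => Metric.infDist x Ωᶜ with hd
  have hd0 : ∀ x, 0 ≤ d x := fun x => Metric.infDist_nonneg
  have hν0 : 0 < ν := by linarith
  set e := Real.exp (ν * M) with he
  have he0 : 0 < e := Real.exp_pos _
  set k := ν * e with hk
  have hk0 : 0 < k := by positivity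
  -- This `ψ` solves `ψ'' = -ν ψ'²` with `ψ(0) = 0` and `ψ'(0) = exp(ν M)`; moreover `ψ ≤ M` exactly
  -- where `ψ' ≥ 1`, for nonnegative arguments.
  set ψ : ℝ → ℝ := fun s => Real.log (1 + k * s) / ν with hψ
  have hψle : ∀ s, 0 ≤ s → ψ s ≤ e * s := by
    intro s hs
    have : Real.log (1 + k * s) ≤ k * s := by
      have := Real.log_le_sub_one_of_pos (show 0 < 1 + k * s by positivity)
      linarith
    simp only [hψ]
    rw [div_le_iff₀ hν0]
    exact this.trans (le_of_eq (by rw [hk]; ring))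
  suffices hmain : ∀ x ∈ closure Ω, u x - φ x - ψ (d x) ≤ 0 by
    intro x hx
    have := hmain x hx
    have := hψle (d x) (hd0 x)
    linarith
  rintro x₁ hx₁
  have hdc : Continuous d := Metric.continuous_infDist_pt _
  have hpos1 : ∀ x, 1 + k * d x ≠ 0 := fun x => by have := hd0 x; positivity
  have hcont : ContinuousOn (fun x => u x - φ x - ψ (d x)) (closure Ω) := by
    refine (huc.sub hφc).sub (Continuous.continuousOn ?_)
    exact ((continuous_const.add (continuous_const.mul hdc)).log hpos1).div_const _
  obtain ⟨x, hx, hmax⟩ := hb.isCompact_closure.exists_isMaxOn ⟨x₁, hx₁⟩ hcont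
  refine (hmax hx₁).trans ?_
  by_contra! hfx
  have hxΩ : x ∈ Ω := by
    by_contra hxn
    have hxf : x ∈ frontier Ω := by rw [hΩ.frontier_eq]; exact ⟨hx, hxn⟩
    have h0 : d x = 0 := Metric.infDist_zero_of_mem hxn
    simp [hbd x hxf, h0, hψ] at hfx
  obtain ⟨y, hy, hxy, hdpos, hball, hycl⟩ := exists_nearest_frontier hΩ hne hxΩ
  obtain ⟨ρ, hρ, htr⟩ := exists_isC2DefiningAt_trace hn hC2 hy
  have huC : ContDiffAt ℝ 2 u x := hu.contDiffAt (hΩ.mem_nhds hxΩ)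
  have hφC : ContDiffAt ℝ 2 φ x := hφ.contDiffAt (hΩ.mem_nhds hxΩ)
  set N := unitNormal ρ y with hN
  set ψ' : ℝ → ℝ := fun s => e / (1 + k * s) with hψ'
  set t := ψ' (d x) with ht
  have hdpos' : 0 < d x := hdpos
  have hden : 0 < 1 + k * d x := by positivity
  have hlin : ∀ s : ℝ, HasDerivAt (fun s : ℝ => 1 + k * s) k s := fun s => by
    simpa using ((hasDerivAt_id s).const_mul k).const_add 1
  have hderψ : ∀ s, 0 < 1 + k * s → HasDerivAt ψ (ψ' s) s := by
    intro s hs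
    refine (((hlin s).log hs.ne').div_const ν).congr_deriv ?_
    simp only [hψ', hk]; field_simp
  have hderψ' : HasDerivAt ψ' (-(ν * t ^ 2)) (d x) := by
    refine (((hlin (d x)).fun_inv hden.ne').const_mul e).congr_deriv ?_
    simp only [ht, hψ', hk]; field_simp
  have hderev : ∀ᶠ s in 𝓝 (d x), HasDerivAt ψ (ψ' s) s := by
    refine ((hlin (d x)).continuousAt.tendsto.eventually (lt_mem_nhds hden)).mono ?_
    exact fun s hs => hderψ s hs
  -- A positive maximum gives `ψ(d x) < u x - φ x ≤ M`, hence `1 + k d ≤ exp(ν M)`.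
  have ht1 : 1 ≤ t := by
    have h1 : ψ (d x) ≤ M := by linarith [hM x hxΩ]
    simp only [hψ] at h1
    rw [div_le_iff₀ hν0, Real.log_le_iff_le_exp hden, mul_comm M] at h1
    rw [ht, hψ', le_div_iff₀ hden, one_mul]; exact h1
  have htd : t * d x ≤ 1 := by
    rw [ht, hψ', div_mul_eq_mul_div, div_le_one hden, hk]
    nlinarith [mul_pos he0 hdpos']
  -- As `ψ` is increasing, replacing `d` by a parabola above it lowers the function nearby and keeps
  -- its value at `x`, so the maximum persists along the line.
  have htouch : ∀ v : EuclideanSpace ℝ (Fin n), ∀ c : ℝ, -secondForm ρ y v v < 2 * c →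
      fderiv ℝ (u - φ) x v = t * ⟪N, v⟫ ∧
      fderiv ℝ (fderiv ℝ (u - φ)) x v v ≤ -(ν * t ^ 2) * ⟪N, v⟫ ^ 2 + 2 * c * t := by
    intro v c hc
    refine second_order_of_isLocalMax_line (huC.sub hφC) v (ψ := ψ) (ψ' := ψ')
      (a := d x) hderev hderψ' ?_
    have hl : Tendsto (fun s : ℝ => x + s • v) (𝓝 0) (𝓝 x) := by
      have : Continuous (fun s : ℝ => x + s • v) := by fun_prop
      simpa using this.tendsto 0
    filter_upwards [hl.eventually (hΩ.mem_nhds hxΩ), hρ.infDist_le_parabola hxy hdpos v hc]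
      with s hs1 hs2
    have h1 : ψ (d (x + s • v)) ≤ ψ (d x + s * ⟪N, v⟫ + s ^ 2 * c) := by
      have := hd0 (x + s • v)
      simp only [hψ]
      gcongr
    have h2 : u (x + s • v) - φ (x + s • v) - ψ (d (x + s • v)) ≤ u x - φ x - ψ (d x) :=
      hmax (subset_closure hs1)
    simp only [zero_smul, add_zero, zero_mul, ne_eq, OfNat.ofNat_ne_zero,
      not_false_eq_true, zero_pow]
    linarith
  have hgrad : gradient u x = gradient φ x + t • N := by
    refine ext_inner_right ℝ fun v => ?_
    have h1 := (htouch v ((1 - secondForm ρ y v v) / 2) (by linarith)).1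
    rw [fderiv_sub (huC.differentiableAt (by simp)) (hφC.differentiableAt (by simp)),
      sub_apply] at h1
    rw [inner_gradient_left, inner_add_left, inner_gradient_left, real_inner_smul_left]
    linarith
  have hS : ∀ v, fderiv ℝ (fderiv ℝ u) x v v ≤
      fderiv ℝ (fderiv ℝ φ) x v v - ν * t ^ 2 * ⟪N, v⟫ ^ 2 - t * secondForm ρ y v v := by
    intro v
    refine le_of_forall_pos_le_add fun ε hε => ?_
    have ht0 : 0 < t := by linarith
    -- The parabola must open strictly more than the curvature prescribes; the excess `ε / t`
    -- becomes `ε` after multiplication by `t`.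
    have h1 := (htouch v ((-secondForm ρ y v v + ε / t) / 2) (by
      have : 0 < ε / t := by positivity
      linarith)).2
    rw [fderiv_fderiv_sub huC hφC, sub_apply, sub_apply] at h1
    have h2 : 2 * ((-secondForm ρ y v v + ε / t) / 2) * t = -(t * secondForm ρ y v v) + ε := by
      field_simp
    linarith
  have hξ : ‖gradient φ x‖ ≤ A := by
    rw [gradient, LinearIsometryEquiv.norm_map]; exact hφA x hxΩ
  have h1 := mcForm_barrier_lt (g := G y) hK0 hh hdpos'.le ht1 htd (hG0 y hy) (hGh y hy) hν
    hρ.norm_unitNormal hξ (hφB x hxΩ) hρ.secondForm_apply_normal (hK y hy ρ hρ)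
    (htr ▸ hGS y hy) hS
  rw [← hN, ← hgrad] at h1
  exact absurd (heq x hxΩ y hy hxy hball hycl) (not_le.2 h1)

end Barrier

/-! ### Derivatives up to the boundary -/

section ClosedDomain

variable {n : ℕ} {Ω : Set (EuclideanSpace ℝ (Fin n))}

/-- At a boundary point the tangent cone contains the open half-space of inward vectors, and these
span the space. -/
theorem uniqueDiffOn_closure (hΩ : IsOpen Ω) (hC2 : HasC2Boundary Ω) :
    UniqueDiffOn ℝ (closure Ω) := by
  intro y hy
  rw [uniqueDiffWithinAt_closure]
  by_cases hyΩ : y ∈ Ω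
  · exact uniqueDiffWithinAt_of_mem_nhds (hΩ.mem_nhds hyΩ)
  obtain ⟨ρ, hρ⟩ := hC2 y (by rw [hΩ.frontier_eq]; exact ⟨hy, hyΩ⟩)
  set N := unitNormal ρ y with hN
  have hNN : ⟪N, N⟫ = 1 := by rw [real_inner_self_eq_norm_sq, hρ.norm_unitNormal]; norm_num
  have hcone : ∀ v, 0 < ⟪N, v⟫ → v ∈ tangentConeAt ℝ Ω y := by
    intro v hv
    refine mem_tangentConeAt_of_add_smul_mem (l := 𝓝[>] (0 : ℝ)) (c := id) ?_
      (hρ.eventually_mem hv)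
    exact tendsto_id.mono_left (nhdsWithin_mono 0 fun s (hs : 0 < s) => hs.ne')
  refine ⟨?_, hy⟩
  have hspan : Submodule.span ℝ (tangentConeAt ℝ Ω y) = ⊤ := by
    rw [eq_top_iff]
    rintro v -
    have hN' := Submodule.subset_span (R := ℝ) (hcone N (by rw [hNN]; exact one_pos))
    have hv := Submodule.subset_span (R := ℝ) (hcone (v + (1 - ⟪N, v⟫) • N) (by
      rw [inner_add_right, real_inner_smul_right, hNN]; linarith))
    have := Submodule.sub_mem _ hv (Submodule.smul_mem _ (1 - ⟪N, v⟫) hN')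
    simpa using this
  rw [hspan]
  exact dense_univ

/-- A derivative at a boundary point inherits the one-sided Lipschitz bound at that point. -/
theorem IsC2DefiningAt.norm_le_of_lipschitzAt {ρ g : EuclideanSpace ℝ (Fin n) → ℝ}
    {y : EuclideanSpace ℝ (Fin n)} (h : IsC2DefiningAt Ω ρ y)
    {D : EuclideanSpace ℝ (Fin n) →L[ℝ] ℝ} (hD : HasFDerivWithinAt g D Ω y) {L : ℝ} (hL : 0 ≤ L)
    (hg : ∀ x ∈ Ω, |g x - g y| ≤ L * ‖x - y‖) : ‖D‖ ≤ L := by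
  set N := unitNormal ρ y with hN
  have hNN : ⟪N, N⟫ = 1 := by rw [real_inner_self_eq_norm_sq, h.norm_unitNormal]; norm_num
  have h1 : ∀ v, 0 < ⟪N, v⟫ → |D v| ≤ L * ‖v‖ := by
    intro v hv
    set S : Set ℝ := {s | 0 < s ∧ y + s • v ∈ Ω} with hS
    have hSmem : S ∈ 𝓝[>] (0 : ℝ) :=
      (eventually_mem_nhdsWithin (s := Ioi (0 : ℝ))).and (h.eventually_mem hv)
    have hline : HasDerivWithinAt (fun s : ℝ => y + s • v) v S 0 := by
      have := (((hasDerivAt_id (0 : ℝ)).smul_const v).const_add y).hasDerivWithinAt (s := S)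
      simpa using this
    have hcomp := hD.comp_hasDerivWithinAt_of_eq (0 : ℝ) hline (fun s hs => hs.2) (by simp)
    rw [hasDerivWithinAt_iff_tendsto_slope' (by simp [hS])] at hcomp
    have : (𝓝[S] (0 : ℝ)).NeBot := by
      refine NeBot.mono (f := 𝓝[>] (0 : ℝ)) inferInstance ?_
      exact le_inf nhdsWithin_le_nhds (le_principal_iff.2 hSmem)
    refine le_of_tendsto hcomp.abs ?_
    filter_upwards [self_mem_nhdsWithin] with s hs
    have hs0 : 0 < s := hs.1
    have := hg _ hs.2
    rw [add_sub_cancel_left, norm_smul, Real.norm_of_nonneg hs0.le] at this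
    simp only [slope_def_field, Function.comp_apply, zero_smul, add_zero, sub_zero]
    rw [abs_div, abs_of_pos hs0, div_le_iff₀ hs0]
    linarith
  have h2 : ∀ v, 0 ≤ ⟪N, v⟫ → |D v| ≤ L * ‖v‖ := by
    intro v hv
    have hl : Tendsto (fun ε : ℝ => |D (v + ε • N)|) (𝓝[>] 0) (𝓝 |D v|) := by
      have : Continuous (fun ε : ℝ => |D (v + ε • N)|) := by fun_prop
      simpa using (this.tendsto 0).mono_left (nhdsWithin_le_nhds (s := Ioi 0))
    have hr : Tendsto (fun ε : ℝ => L * ‖v + ε • N‖) (𝓝[>] 0) (𝓝 (L * ‖v‖)) := by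
      have : Continuous (fun ε : ℝ => L * ‖v + ε • N‖) := by fun_prop
      simpa using (this.tendsto 0).mono_left (nhdsWithin_le_nhds (s := Ioi 0))
    refine le_of_tendsto_of_tendsto hl hr ?_
    filter_upwards [self_mem_nhdsWithin] with ε hε
    have hε' : (0 : ℝ) < ε := hε
    apply h1
    rw [inner_add_right, real_inner_smul_right, hNN]
    linarith
  refine D.opNorm_le_bound hL fun v => ?_
  rcases le_total 0 ⟪N, v⟫ with hv | hv
  · exact h2 v hv
  · simpa using h2 (-v) (by rw [inner_neg_right]; linarith)

theorem le_of_continuousWithinAt_closure {f : EuclideanSpace ℝ (Fin n) → ℝ} {C : ℝ}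
    {S : Set (EuclideanSpace ℝ (Fin n))} {y : EuclideanSpace ℝ (Fin n)}
    (hf : ContinuousWithinAt f S y) (hy : y ∈ closure S) (h : ∀ x ∈ S, f x ≤ C) : f y ≤ C := by
  have := mem_closure_iff_nhdsWithin_neBot.1 hy
  exact le_of_tendsto hf (eventually_mem_nhdsWithin.mono h)

/-- A Lipschitz bound from the centre of a ball to its closure. -/
theorem abs_sub_le_of_mem_closure_ball (hΩ : IsOpen Ω) {f : EuclideanSpace ℝ (Fin n) → ℝ} {C r : ℝ}
    (hf : ContDiffOn ℝ 1 f (closure Ω)) (hC : ∀ x ∈ Ω, ‖fderiv ℝ f x‖ ≤ C)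
    {x y : EuclideanSpace ℝ (Fin n)} (hr : 0 < r) (hball : Metric.ball x r ⊆ Ω)
    (hy : y ∈ closure (Metric.ball x r)) : |f y - f x| ≤ C * dist x y := by
  have hdiff : ∀ z ∈ Metric.ball x r, DifferentiableAt ℝ f z := fun z hz =>
    ((hf.mono subset_closure).contDiffAt (hΩ.mem_nhds (hball hz))).differentiableAt (by simp)
  have h1 : ∀ z ∈ Metric.ball x r, |f z - f x| - C * dist x z ≤ 0 := by
    intro z hz
    -- The mean value inequality is applied in the inscribed ball because `Ω` need not be convex.
    have := (convex_ball x r).norm_image_sub_le_of_norm_fderiv_le hdiff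
      (fun z hz => hC z (hball hz)) (Metric.mem_ball_self hr) hz
    rw [dist_comm, dist_eq_norm]
    simpa using this
  have h2 : ContinuousWithinAt f (Metric.ball x r) y :=
    (hf.continuousOn.continuousWithinAt (closure_mono hball hy)).mono (hball.trans subset_closure)
  have h3 : ContinuousWithinAt (fun z => |f z - f x| - C * dist x z) (Metric.ball x r) y :=
    (h2.sub continuousWithinAt_const).abs.sub
      (by fun_prop : Continuous fun z => C * dist x z).continuousWithinAt
  have := le_of_continuousWithinAt_closure h3 hy h1
  linarith

/-! ### The `C^k` norm -/

/-- An unbounded real supremum would take the default value `0`, so boundedness must come first: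
derivatives within the closure are continuous on a compact set and agree with the ordinary ones
inside. -/
theorem norm_iteratedFDeriv_le_ckNorm (hΩ : IsOpen Ω) (hb : Bornology.IsBounded Ω)
    (hC2 : HasC2Boundary Ω) {k : ℕ} {f : EuclideanSpace ℝ (Fin n) → ℝ}
    (hf : ContDiffOn ℝ k f (closure Ω)) {j : ℕ} (hj : j ≤ k) {x : EuclideanSpace ℝ (Fin n)}
    (hx : x ∈ Ω) : ‖iteratedFDeriv ℝ j f x‖ ≤ ckNorm Ω k f := by
  have hcont : ContinuousOn (fun z => ‖iteratedFDerivWithin ℝ j f (closure Ω) z‖) (closure Ω) :=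
    (hf.continuousOn_iteratedFDerivWithin (by exact_mod_cast hj)
      (uniqueDiffOn_closure hΩ hC2)).norm
  obtain ⟨C, hC⟩ := hb.isCompact_closure.bddAbove_image hcont
  have hbdd : BddAbove (range fun z : Ω => ‖iteratedFDeriv ℝ j f z‖) := by
    refine ⟨C, ?_⟩
    rintro _ ⟨⟨z, hz⟩, rfl⟩
    have hcl : (closure Ω : Set _) =ᶠ[𝓝 z] (univ : Set _) := by
      rw [eventuallyEq_univ]
      exact mem_of_superset (hΩ.mem_nhds hz) subset_closure
    have := hC (mem_image_of_mem _ (subset_closure hz))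
    rwa [iteratedFDerivWithin_congr_set hcl, iteratedFDerivWithin_univ] at this
  refine (le_ciSup hbdd ⟨x, hx⟩).trans ?_
  exact Finset.single_le_sum (f := fun j => ⨆ x : Ω, ‖iteratedFDeriv ℝ j f x‖)
    (fun i _ => Real.iSup_nonneg fun _ => norm_nonneg _) (Finset.mem_range_succ_iff.2 hj)

theorem ckNorm_nonneg (k : ℕ) (f : EuclideanSpace ℝ (Fin n) → ℝ) : 0 ≤ ckNorm Ω k f :=
  Finset.sum_nonneg fun _ _ => Real.iSup_nonneg fun _ => norm_nonneg _

theorem norm_fderiv_fderiv (f : EuclideanSpace ℝ (Fin n) → ℝ) (x : EuclideanSpace ℝ (Fin n)) :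
    ‖fderiv ℝ (fderiv ℝ f) x‖ = ‖iteratedFDeriv ℝ 2 f x‖ := by
  rw [← norm_iteratedFDeriv_one, norm_iteratedFDeriv_fderiv]

end ClosedDomain

section Main

variable {n : ℕ} {Ω : Set (EuclideanSpace ℝ (Fin n))}

theorem compl_nonempty (hn : 2 ≤ n) (hb : Bornology.IsBounded Ω) : Ωᶜ.Nonempty := by
  rw [nonempty_compl]
  rintro rfl
  have : Nonempty (Fin n) := ⟨⟨0, by omega⟩⟩
  exact NormedSpace.unbounded_univ ℝ (EuclideanSpace ℝ (Fin n)) hb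

theorem gradient_neg (u : EuclideanSpace ℝ (Fin n) → ℝ) (x : EuclideanSpace ℝ (Fin n)) :
    gradient (-u) x = -gradient u x := by
  rw [gradient, gradient, fderiv_neg, map_neg]

end Main

end PrescribedMC

end

/-! ### The boundary gradient estimate -/

theorem mainTheorem4 (n : ℕ) (hn : 2 ≤ n) (Ω : Set (EuclideanSpace ℝ (Fin n)))
    (hΩ_open : IsOpen Ω) (hΩ_conn : IsConnected Ω) (hΩ_bdd : Bornology.IsBounded Ω)
    (hΩ_C2 : PrescribedMC.HasC2Boundary Ω) :
    ∃ C : ℝ, 0 < C ∧ ∀ φ H u : EuclideanSpace ℝ (Fin n) → ℝ,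
      ContDiffOn ℝ 2 φ (closure Ω) →
      ContDiffOn ℝ 1 H (closure Ω) →
      (∀ y ∈ frontier Ω,
        ((n : ℝ) - 1) * PrescribedMC.boundaryMeanCurvature Ω y ≥ (n : ℝ) * |H y|) →
      ContDiffOn ℝ 2 u Ω →
      ContDiffOn ℝ 1 u (closure Ω) →
      PrescribedMC.IsSolution Ω H φ u →
      ∀ y ∈ frontier Ω, ‖gradientWithin u (closure Ω) y‖ ≤
        PrescribedMC.ckNorm Ω 1 φ +
          Real.exp (C * (1 + PrescribedMC.ckNorm Ω 1 H + PrescribedMC.ckNorm Ω 2 φ)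
            * (1 + PrescribedMC.ckNorm Ω 1 φ) ^ 3
            * (PrescribedMC.ckNorm Ω 0 u + PrescribedMC.ckNorm Ω 0 φ)) := by
  open PrescribedMC Set Filter Topology in
  have hcpt : IsCompact (frontier Ω) :=
    Metric.isCompact_of_isClosed_isBounded isClosed_frontier
      (hΩ_bdd.closure.subset frontier_subset_closure)
  obtain ⟨K, hK0, hK⟩ := exists_secondForm_bound hΩ_open hcpt hΩ_C2
  have hne := compl_nonempty hn hΩ_bdd
  -- The first three summands match the three error terms in the lower bound required of `ν`; the
  -- final `1` makes it strict.
  refine ⟨4 * (n + 1) + K + 12 * n + 1, by positivity, ?_⟩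
  intro φ H u hφ hH hS hu hu1 hsol y hy
  have hφ1 : ContDiffOn ℝ 1 φ (closure Ω) := hφ.of_le (by norm_num)
  set A := ckNorm Ω 1 φ with hA
  set B := ckNorm Ω 2 φ with hB
  set h := ckNorm Ω 1 H with hh
  set M := ckNorm Ω 0 u + ckNorm Ω 0 φ with hM
  set ν := (4 * (n + 1) + K + 12 * n + 1) * (1 + h + B) * (1 + A) ^ 3 with hν
  have hA0 : 0 ≤ A := ckNorm_nonneg _ _
  have hB0 : 0 ≤ B := ckNorm_nonneg _ _
  have hh0 : 0 ≤ h := ckNorm_nonneg _ _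
  have hφA : ∀ x ∈ Ω, ‖fderiv ℝ φ x‖ ≤ A := fun x hx => by
    rw [← norm_iteratedFDeriv_one]
    exact norm_iteratedFDeriv_le_ckNorm hΩ_open hΩ_bdd hΩ_C2 (by exact_mod_cast hφ1) le_rfl hx
  have hφB : ∀ x ∈ Ω, ‖fderiv ℝ (fderiv ℝ φ) x‖ ≤ B := fun x hx => by
    rw [norm_fderiv_fderiv]
    exact norm_iteratedFDeriv_le_ckNorm hΩ_open hΩ_bdd hΩ_C2 (by exact_mod_cast hφ) le_rfl hx
  have hHA : ∀ x ∈ Ω, ‖fderiv ℝ H x‖ ≤ h := fun x hx => by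
    rw [← norm_iteratedFDeriv_one]
    exact norm_iteratedFDeriv_le_ckNorm hΩ_open hΩ_bdd hΩ_C2 (by exact_mod_cast hH) le_rfl hx
  have hH0 : ∀ x ∈ Ω, |H x| ≤ h := fun x hx => by
    rw [← Real.norm_eq_abs, ← norm_iteratedFDeriv_zero (𝕜 := ℝ)]
    exact norm_iteratedFDeriv_le_ckNorm hΩ_open hΩ_bdd hΩ_C2 (by exact_mod_cast hH) zero_le_one hx
  have hφ0 : ∀ x ∈ Ω, |φ x| ≤ ckNorm Ω 0 φ := fun x hx => by
    rw [← Real.norm_eq_abs, ← norm_iteratedFDeriv_zero (𝕜 := ℝ)]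
    exact norm_iteratedFDeriv_le_ckNorm hΩ_open hΩ_bdd hΩ_C2
      (hφ1.of_le (by norm_num)) le_rfl hx
  have hu0 : ∀ x ∈ Ω, |u x| ≤ ckNorm Ω 0 u := fun x hx => by
    rw [← Real.norm_eq_abs, ← norm_iteratedFDeriv_zero (𝕜 := ℝ)]
    exact norm_iteratedFDeriv_le_ckNorm hΩ_open hΩ_bdd hΩ_C2
      (hu1.of_le (by norm_num)) le_rfl hx
  -- The norm only sees the open set, so the bound on the boundary comes from continuity.
  have hHf : ∀ z ∈ frontier Ω, |H z| ≤ h := fun z hz =>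
    le_of_continuousWithinAt_closure (f := fun x => |H x|)
      ((hH.continuousOn.continuousWithinAt (frontier_subset_closure hz)).mono subset_closure).abs
      (frontier_subset_closure hz) hH0
  have hν1 : 1 ≤ ν := by
    have e1 : 1 ≤ 4 * ((n : ℝ) + 1) + K + 12 * n + 1 := by
      have : (0 : ℝ) ≤ n := by positivity
      linarith
    have e2 : 1 ≤ (1 + A) ^ 3 := one_le_pow₀ (by linarith)
    exact one_le_mul_of_one_le_of_one_le
      (one_le_mul_of_one_le_of_one_le e1 (by linarith)) e2
  have hνlt : 4 * (n + 1) * (1 + A) ^ 2 * B + K * A ^ 2 + 12 * n * h * (1 + A) ^ 3 < ν := by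
    have e2 : (1 + A) ^ 2 ≤ (1 + A) ^ 3 := pow_le_pow_right₀ (by linarith) (by norm_num)
    have e3 : A ^ 2 ≤ (1 + A) ^ 3 := le_trans (by gcongr; linarith) e2
    have e1 : (0 : ℝ) ≤ n := by positivity
    have e4 : 4 * (n + 1) * (1 + A) ^ 2 * B ≤ 4 * (n + 1) * (1 + A) ^ 3 * B := by gcongr
    have e5 : K * A ^ 2 ≤ K * (1 + A) ^ 3 := by gcongr
    have e6 : (4 * (n + 1) * B + K + 12 * n * h) * (1 + A) ^ 3 < ν := by
      rw [hν]
      gcongr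
      nlinarith [mul_nonneg e1 hh0, mul_nonneg e1 hB0, mul_nonneg hK0 hh0, mul_nonneg hK0 hB0]
    linarith
  have hlip : ∀ x ∈ Ω, ∀ z ∈ frontier Ω, dist x z = Metric.infDist x Ωᶜ →
      Metric.ball x (Metric.infDist x Ωᶜ) ⊆ Ω → z ∈ closure (Metric.ball x (Metric.infDist x Ωᶜ)) →
      |n * H x| ≤ n * |H z| + n * h * Metric.infDist x Ωᶜ := by
    intro x hx z hz hxz hball hzcl
    have hr : 0 < Metric.infDist x Ωᶜ :=
      (hΩ_open.isClosed_compl.notMem_iff_infDist_pos hne).1 (by simpa using hx)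
    have h1 := abs_sub_le_of_mem_closure_ball hΩ_open hH hHA hr hball hzcl
    rw [hxz] at h1
    have h2 : |H x| ≤ |H z| + h * Metric.infDist x Ωᶜ := by
      have := abs_sub_abs_le_abs_sub (H x) (H z)
      rw [abs_sub_comm] at this
      linarith
    rw [abs_mul, abs_of_nonneg (by positivity : (0 : ℝ) ≤ n)]
    calc (n : ℝ) * |H x| ≤ n * (|H z| + h * Metric.infDist x Ωᶜ) := by gcongr
      _ = _ := by ring
  have heq : ∀ x ∈ Ω, mcForm (gradient u x) (fderiv ℝ (fderiv ℝ u) x)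
      = n * H x * Real.sqrt (1 + ‖gradient u x‖ ^ 2) ^ 3 := fun x hx => by
    rw [← divergence_eq_mcForm (hu.contDiffAt (hΩ_open.mem_nhds hx)), hsol.equation x hx]
  have upper := sub_le_barrier hn hΩ_open hΩ_bdd hΩ_C2 hne hK0 hK (G := fun z => n * |H z|)
    (M := M) hh0 hu (hφ.mono subset_closure) hu1.continuousOn hφ.continuousOn hφA hφB
    (fun x hx => by linarith [le_of_abs_le (hu0 x hx), neg_le_of_abs_le (hφ0 x hx)])
    hsol.boundary (fun z _ => by positivity) (fun z hz => by have := hHf z hz; gcongr) hS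
    (fun x hx z hz hxz hball hzcl => by
      rw [heq x hx]
      gcongr
      exact neg_le_of_abs_le (hlip x hx z hz hxz hball hzcl)) hν1 hνlt
  -- The operator is odd, so `-u` solves the problem with data `-φ` and `-H`; the Serrin condition
  -- involves only `|H|` and is unchanged.
  have lower := sub_le_barrier hn hΩ_open hΩ_bdd hΩ_C2 hne hK0 hK (u := -u) (φ := -φ)
    (G := fun z => n * |H z|)
    (M := M) hh0 hu.neg (hφ.mono subset_closure).neg hu1.continuousOn.neg hφ.continuousOn.neg
    (fun x hx => by rw [fderiv_neg, norm_neg]; exact hφA x hx)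
    (fun x hx => by rw [norm_fderiv_fderiv_neg]; exact hφB x hx)
    (fun x hx => by
      simp only [Pi.neg_apply]
      linarith [neg_le_of_abs_le (hu0 x hx), le_of_abs_le (hφ0 x hx)])
    (fun z hz => by simp [hsol.boundary z hz]) (fun z _ => by positivity)
    (fun z hz => by have := hHf z hz; gcongr) hS
    (fun x hx z hz hxz hball hzcl => by
      rw [gradient_neg, fderiv_fderiv_neg, mcForm_neg, heq x hx, norm_neg, ← neg_mul]
      gcongr
      exact le_of_abs_le (hlip x hx z hz hxz hball hzcl)) hν1 hνlt
  obtain ⟨ρ, hρ⟩ := hΩ_C2 y hy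
  have hycl := frontier_subset_closure hy
  have hyn := notMem_of_mem_frontier hΩ_open hy
  have hud := uniqueDiffOn_closure hΩ_open hΩ_C2
  have hud' := hud y hycl
  have huD := (hu1 y hycl).differentiableWithinAt (by simp)
  have hφD := (hφ1 y hycl).differentiableWithinAt (by simp)
  -- The two barriers give `|u - φ| ≤ exp(ν M) d`, and `d x ≤ ‖x - y‖` turns this into a Lipschitz
  -- bound at `y`, where `u - φ` vanishes.
  have hdiff : ‖fderivWithin ℝ u (closure Ω) y - fderivWithin ℝ φ (closure Ω) y‖
      ≤ Real.exp (ν * M) := by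
    refine hρ.norm_le_of_lipschitzAt
      ((huD.hasFDerivWithinAt.sub hφD.hasFDerivWithinAt).mono subset_closure) (by positivity) ?_
    intro x hx
    have h1 := upper x (subset_closure hx)
    have h2 := lower x (subset_closure hx)
    have h3 : Metric.infDist x Ωᶜ ≤ ‖x - y‖ := by
      rw [← dist_eq_norm]; exact Metric.infDist_le_dist_of_mem hyn
    have h4 : Real.exp (ν * M) * Metric.infDist x Ωᶜ ≤ Real.exp (ν * M) * ‖x - y‖ := by gcongr
    simp only [Pi.sub_apply, Pi.neg_apply, hsol.boundary y hy, sub_self, sub_zero] at h2 ⊢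
    exact abs_le.2 ⟨by linarith, by linarith⟩
  have hφy : ‖fderivWithin ℝ φ (closure Ω) y‖ ≤ A := by
    refine le_of_continuousWithinAt_closure (f := fun x => ‖fderivWithin ℝ φ (closure Ω) x‖)
      (((hφ1.continuousOn_fderivWithin hud (by simp)).continuousWithinAt hycl).mono
        subset_closure).norm hycl fun x hx => ?_
    rw [fderivWithin_of_mem_nhds (mem_of_superset (hΩ_open.mem_nhds hx) subset_closure)]
    exact hφA x hx
  rw [gradientWithin, LinearIsometryEquiv.norm_map]
  have := norm_add_le (fderivWithin ℝ φ (closure Ω) y)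
    (fderivWithin ℝ u (closure Ω) y - fderivWithin ℝ φ (closure Ω) y)
  rw [add_sub_cancel] at this
  linarith
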